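/- **Lemma 3.1.** Let $\Omega\subset\mathbb R^2$ be a bounded convex domain, $S\subset\partial\Omega$, $N=\partial\Omega\setminus S$, $r_0>0$, and let $x\in N$ with $d(x,S)\ge r_0$. Write $B_r=B_r(x)$ and $S_r=\partial B_r(x)$. For $0<R\le r_0$ let $u$ be a real function on $\Omega$ such that $d(x,\Gamma)<r_0$, where $\Gamma=\partial\{u>0\}\cap\Omega$, and * $u\in C(B_R\cap\Omega)\cap H^1(B_R\cap\Omega)$, * $\Delta u=0$ in $(B_R\cap\Omega)\setminus\{u=0\}$, * $\partial_\nu u=0$ weakly on $N$ inside $B_R$, i.e. $\int_{B_R\cap\Omega}\nabla u\cdot\nabla\varphi\,dy=0$ for every $\varphi\in H^1(B_R\cap\Omega)$ that vanishes near $\partial(B_R\cap\Omega)\setminus(N\cap B_R)$ and vanishes on $\{|u|<\varepsilon\}$ for some $\varepsilon>0$. Then $u^{+}=\max(u,0)$ and $u^-=\max(-u,0)$ belong to $H^1(B_R\cap\Omega)$, and the function $$\phi(r)=\frac1{r^4}\int_{B_r\cap\Omega}|\nabla u^+|^2\,dy\cdot\int_{B_r\cap\Omega}|\nabla u^-|^2\,dy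 ,\qquad 0<r\le R,$$ satisfies $\phi'(r)\ge 0$ at all radii for which $S_r\cap\Omega$ is a single arc, in the following sense: for almost every $r\in(0,R)$ for which $S_r\cap\Omega$ is non-empty and connected, $\phi$ is differentiable at $r$ and $\phi'(r)\ge0$; and if $0\le a<b\le R$ and $S_r\cap\Omega$ is non-empty and connected for every $r\in(a,b)$, then $\phi$ is nondecreasing on $(a,b]$. Moreover there is $\rho>0$, depending only on $\Omega$ and $x$, such that $S_r\cap\Omega$ is non-empty and connected for every $r\in(0,\rho)$. In particular $\phi$ is nondecreasing on $(0,\min(R,\rho)]$. -/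

import Mathlib

open MeasureTheory Set Filter Topology
open scoped ContDiff

noncomputable section

namespace ACFNeumann

/-- The Euclidean plane `ℝ²`. -/
abbrev Plane : Type := EuclideanSpace ℝ (Fin 2)

/-- `g` is a weak (distributional) gradient of `f` on the open set `U`:
`∫_U f ∂_v ψ = - ∫_U (g · v) ψ` for every `ψ ∈ C_c^∞(U)` and every direction `v`. -/
def HasWeakGradOn (U : Set Plane) (f : Plane → ℝ) (g : Plane → Plane) : Prop :=
  LocallyIntegrableOn f U volume ∧ LocallyIntegrableOn g U volume ∧
    ∀ ψ : Plane → ℝ, ContDiff ℝ ∞ ψ → HasCompactSupport ψ → tsupport ψ ⊆ U →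
      ∀ v : Plane,
        ∫ y in U, f y * fderiv ℝ ψ y v = - ∫ y in U, inner ℝ (g y) v * ψ y

/-- `f ∈ H¹(U)`: `f` is square integrable on `U` and has a square integrable weak gradient. -/
def MemH1 (U : Set Plane) (f : Plane → ℝ) : Prop :=
  MemLp f 2 (volume.restrict U) ∧
    ∃ g : Plane → Plane, MemLp g 2 (volume.restrict U) ∧ HasWeakGradOn U f g

open Classical in
/-- The weak gradient `∇f` of `f` on `U` (unique up to null sets); it is only used for functions
that have a weak gradient, and is `0` by convention for the others. -/
def weakGrad (U : Set Plane) (f : Plane → ℝ) : Plane → Plane :=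
  if h : ∃ g : Plane → Plane, HasWeakGradOn U f g then h.choose else 0

/-- The positive part `u⁺ = max(u, 0)`. -/
def posPt (u : Plane → ℝ) : Plane → ℝ := fun y => max (u y) 0

/-- The negative part `u⁻ = max(-u, 0)`. -/
def negPt (u : Plane → ℝ) : Plane → ℝ := fun y => max (-u y) 0

/-- The free boundary `Γ = ∂{u > 0} ∩ Ω`. -/
def freeBoundary (Ω : Set Plane) (u : Plane → ℝ) : Set Plane :=
  frontier {y | y ∈ Ω ∧ 0 < u y} ∩ Ω

/-- Weak Neumann condition `∂_ν u = 0` along `N ⊆ ∂U` for a function `u` on `U` that is harmonic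
only off `{u = 0}`: `∫_U ∇u · ∇φ = 0` for every `φ ∈ H¹(U)` which vanishes near `∂U \ N` and near
the zero set of `u`. No vanishing of `φ` along `N` is required. "Near the zero set" means: on
`{|u| < ε}` for some `ε > 0`. -/
def NeumannWeakly (U N : Set Plane) (u : Plane → ℝ) : Prop :=
  ∀ φ : Plane → ℝ, MemH1 U φ →
    (∃ V : Set Plane, IsOpen V ∧ frontier U \ N ⊆ V ∧ ∀ y ∈ U ∩ V, φ y = 0) →
    (∃ ε : ℝ, 0 < ε ∧ ∀ y ∈ U, |u y| < ε → φ y = 0) →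
      ∫ y in U, inner ℝ (weakGrad U u y) (weakGrad U φ y) = 0

/-- The Dirichlet energy `∫_U |∇f|²`. -/
def energy (U : Set Plane) (f : Plane → ℝ) : ℝ :=
  ∫ y in U, ‖weakGrad U f y‖ ^ 2

/-- The functional `φ(r) = r⁻⁴ ∫_{B_r(x) ∩ Ω} |∇u⁺|² · ∫_{B_r(x) ∩ Ω} |∇u⁻|²`. -/
def acfPhi (Ω : Set Plane) (u : Plane → ℝ) (x : Plane) (r : ℝ) : ℝ :=
  1 / r ^ 4 * (energy (Metric.ball x r ∩ Ω) (posPt u) * energy (Metric.ball x r ∩ Ω) (negPt u))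

end ACFNeumann

end

/-!
The monotonicity of `φ` is the Alt-Caffarelli-Friedman argument, carried out on arcs with free
end points.

Harmonicity enters only through the weak formulation and through the fact that `u` is `C¹` off its
zero set; `Admissible` records what is used, in a form invariant under `u ↦ -u`. Composing `u` with
the `C¹` truncation `rampInt ε`, which vanishes near `(-∞, 0]`, gives `C¹` functions on all of
`B_R ∩ Ω`. Their limit as `ε → 0` identifies the weak gradient of `u⁺` with `1_{u > 0} ∇u`, and
testing the Neumann condition with their product by a radial cut-off gives, after passing to polar
coordinates, the identity `A(r) = ∫_{S_r ∩ Ω} u⁺ ∂_r u⁺` for almost every `r`, where `A(r)` is the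
energy of `u⁺` in `B_r ∩ Ω` (`Admissible.ae_discEnergy_eq_flux`). Also `A'(r)` is the integral of
`|∇u⁺|²` over `S_r ∩ Ω` for almost every `r`.

Since `Ω` is convex and `x` is a boundary point, `Ω` lies in a half-plane with `x` on its edge, so a
single arc `S_r ∩ Ω` has angular length at most `π`. If `u` changes sign on it, let `ℓ₁` and `ℓ₂` be
the angular measures of `{u > 0}` and `{u < 0}`. Each of the two sets misses part of the arc, and
the one-dimensional Wirtinger inequality with one free end (`lintegral_sq_le_of_nonpos`) bounds
`∫ (u⁺)²` by `(2 ℓ₁ / π)² ∫ (∂_θ u⁺)²`. With Young's inequality the flux identity becomes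
`π A(r) ≤ ℓ₁ r A'(r)` (`Admissible.circleInt_flux_le`), similarly for `u⁻`, and
`π / ℓ₁ + π / ℓ₂ ≥ 4 π / (ℓ₁ + ℓ₂) ≥ 4` gives `φ' ≥ 0` (`Admissible.ae_four_mul_le`). If `u` does
not change sign, one of the two fluxes, hence one of the energies, vanishes. Both energies are
absolutely continuous in `r`, so `φ` is nondecreasing on intervals of such radii.

That small circles meet `Ω` in one arc (`exists_isConnected_sphere_inter`) follows from convexity,
by comparing with chords from two fixed directions inside the tangent cone at `x`.
-/

noncomputable section

namespace ACFNeumann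

/-! ### Weak gradients -/

theorem inner_gradient_left {f : Plane → ℝ} {y : Plane} (v : Plane) :
    inner ℝ (gradient f y) v = fderiv ℝ f y v := by
  rw [gradient, InnerProductSpace.toDual_symm_apply]

theorem continuousOn_gradient {U : Set Plane} (hU : IsOpen U) {f : Plane → ℝ}
    (hf : ContDiffOn ℝ 1 f U) : ContinuousOn (gradient f) U := by
  have h : ContinuousOn (fderiv ℝ f) U := hf.continuousOn_fderiv_of_isOpen hU le_rfl
  exact (InnerProductSpace.toDual ℝ Plane).symm.continuous.comp_continuousOn h

theorem setIntegral_eq_integral_of_eq_zero {U : Set Plane} {F : Plane → ℝ}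
    (h : ∀ y ∉ U, F y = 0) : ∫ y in U, F y = ∫ y, F y :=
  setIntegral_eq_integral_of_forall_compl_eq_zero h

theorem eq_zero_of_notMem_of_tsupport {U : Set Plane} {ψ : Plane → ℝ} (hψ : tsupport ψ ⊆ U)
    {y : Plane} (hy : y ∉ U) : ψ y = 0 :=
  image_eq_zero_of_notMem_tsupport fun h => hy (hψ h)

theorem fderiv_eq_zero_of_notMem_of_tsupport {U : Set Plane} {ψ : Plane → ℝ}
    (hψ : tsupport ψ ⊆ U) {y : Plane} (hy : y ∉ U) : fderiv ℝ ψ y = 0 :=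
  image_eq_zero_of_notMem_tsupport fun h => hy (hψ (tsupport_fderiv_subset ℝ h))

/-- A classical gradient is a weak gradient. -/
theorem hasWeakGradOn_of_contDiffOn {U : Set Plane} (hU : IsOpen U) {f : Plane → ℝ}
    (hf : ContDiffOn ℝ 1 f U) : HasWeakGradOn U f (gradient f) := by
  have hg := continuousOn_gradient hU hf
  refine ⟨hf.continuousOn.locallyIntegrableOn hU.measurableSet,
    hg.locallyIntegrableOn hU.measurableSet, ?_⟩
  intro ψ hψ hc hs v
  have hψ' : Continuous (fun y => fderiv ℝ ψ y v) :=
    (hψ.continuous_fderiv (by simp)).clm_apply continuous_const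
  have key : ∀ F : Plane → ℝ, ContinuousOn F U → (∀ y ∉ tsupport ψ, F y = 0) →
      Integrable F := by
    intro F hF h0
    refine (integrableOn_iff_integrable_of_support_subset (s := tsupport ψ) ?_).1
      ((hF.mono hs).integrableOn_compact hc)
    intro y hy
    by_contra h
    exact hy (h0 y h)
  have h0 : ∀ y ∉ tsupport ψ, ψ y = 0 := fun y hy => image_eq_zero_of_notMem_tsupport hy
  have h1 : ∀ y ∉ tsupport ψ, fderiv ℝ ψ y v = 0 := fun y hy => by
    rw [fderiv_eq_zero_of_notMem_of_tsupport subset_rfl hy]; rfl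
  rw [setIntegral_eq_integral_of_eq_zero (fun y hy => by rw [h1 y (fun h => hy (hs h)), mul_zero]),
    setIntegral_eq_integral_of_eq_zero (fun y hy => by rw [h0 y (fun h => hy (hs h)), mul_zero])]
  have := integral_bilinear_hasLineDerivAt_right_eq_neg_left_of_integrable (μ := volume)
    (f := f) (f' := fun y => inner ℝ (gradient f y) v) (g := ψ) (g' := fun y => fderiv ℝ ψ y v)
    (v := v) (B := ContinuousLinearMap.mul ℝ ℝ) ?_ ?_ ?_ ?_ ?_
  · simpa using this
  · exact key _ ((hg.inner continuousOn_const).mul hψ.continuous.continuousOn)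
      fun y hy => by simp [h0 y hy]
  · exact key _ (hf.continuousOn.mul hψ'.continuousOn) fun y hy => by simp [h1 y hy]
  · exact key _ (hf.continuousOn.mul hψ.continuous.continuousOn) fun y hy => by simp [h0 y hy]
  · intro y hy
    have : DifferentiableAt ℝ f y :=
      (hf.contDiffAt (hU.mem_nhds (hs hy))).differentiableAt (by simp)
    rw [inner_gradient_left]
    exact this.hasFDerivAt.hasLineDerivAt v
  · intro y _
    exact (hψ.differentiable (by simp) y).hasFDerivAt.hasLineDerivAt v

theorem integrableOn_inner_mul_of_hasCompactSupport {U : Set Plane}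
    {ψ : Plane → ℝ} (hψ : Continuous ψ) (hc : HasCompactSupport ψ) (hs : tsupport ψ ⊆ U)
    {g : Plane → Plane} (hg : LocallyIntegrableOn g U volume) (v : Plane) :
    IntegrableOn (fun y => inner ℝ (g y) v * ψ y) U volume := by
  have h1 : IntegrableOn g (tsupport ψ) volume := hg.integrableOn_compact_subset hs hc
  have h2 : IntegrableOn (fun y => inner ℝ (g y) v * ψ y) (tsupport ψ) volume := by
    have h3 : IntegrableOn (fun y => inner ℝ (g y) v) (tsupport ψ) volume := h1.inner_const v
    exact IntegrableOn.mul_continuousOn h3 hψ.continuousOn hc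
  refine ((integrableOn_iff_integrable_of_support_subset (s := tsupport ψ) ?_).1 h2).integrableOn
  intro y hy
  by_contra h
  exact hy (by simp [image_eq_zero_of_notMem_tsupport h])

/-- Weak gradients are unique up to null sets. -/
theorem HasWeakGradOn.ae_eq {U : Set Plane} (hU : IsOpen U) {f : Plane → ℝ}
    {g₁ g₂ : Plane → Plane} (h₁ : HasWeakGradOn U f g₁) (h₂ : HasWeakGradOn U f g₂) :
    g₁ =ᵐ[volume.restrict U] g₂ := by
  have hl : LocallyIntegrableOn (fun y => g₁ y - g₂ y) U volume := h₁.2.1.sub h₂.2.1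
  have := hU.ae_eq_zero_of_integral_contDiff_smul_eq_zero hl ?_
  · rw [EventuallyEq, ae_restrict_iff' hU.measurableSet]
    filter_upwards [this] with y hy hyU
    exact sub_eq_zero.1 (hy hyU)
  · intro ψ hψ hc hs
    have hint : Integrable (fun y => ψ y • (g₁ y - g₂ y)) := by
      refine (integrableOn_iff_integrable_of_support_subset (s := tsupport ψ) ?_).1
        ((hl.integrableOn_compact_subset hs hc).continuousOn_smul hψ.continuous.continuousOn hc)
      intro y hy
      by_contra h
      exact hy (by simp [image_eq_zero_of_notMem_tsupport h])
    refine ext_inner_right ℝ fun v => ?_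
    rw [inner_zero_left, real_inner_comm, ← integral_inner hint]
    have e1 := h₁.2.2 ψ hψ hc hs v
    have e2 := h₂.2.2 ψ hψ hc hs v
    have i1 := integrableOn_inner_mul_of_hasCompactSupport hψ.continuous hc hs h₁.2.1 v
    have i2 := integrableOn_inner_mul_of_hasCompactSupport hψ.continuous hc hs h₂.2.1 v
    rw [← setIntegral_eq_integral_of_eq_zero (U := U)
      (fun y hy => by simp [eq_zero_of_notMem_of_tsupport hs hy])]
    have e3 : ∀ y, inner ℝ v (ψ y • (g₁ y - g₂ y)) =
        inner ℝ (g₁ y) v * ψ y - inner ℝ (g₂ y) v * ψ y := by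
      intro y
      rw [inner_smul_right, inner_sub_right, real_inner_comm v, real_inner_comm v]
      ring
    simp_rw [e3]
    rw [integral_sub i1 i2]
    linarith

theorem HasWeakGradOn.mono {U V : Set Plane} (hVU : V ⊆ U)
    {f : Plane → ℝ} {g : Plane → Plane} (h : HasWeakGradOn U f g) : HasWeakGradOn V f g := by
  refine ⟨h.1.mono_set hVU, h.2.1.mono_set hVU, fun ψ hψ hc hs v => ?_⟩
  have := h.2.2 ψ hψ hc (hs.trans hVU) v
  have hsU := hs.trans hVU
  rw [setIntegral_eq_integral_of_eq_zero
      (fun y hy => by rw [fderiv_eq_zero_of_notMem_of_tsupport hsU hy]; simp),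
    setIntegral_eq_integral_of_eq_zero
      (fun y hy => by rw [eq_zero_of_notMem_of_tsupport hsU hy, mul_zero])] at this
  rw [setIntegral_eq_integral_of_eq_zero
      (fun y hy => by rw [fderiv_eq_zero_of_notMem_of_tsupport hs hy]; simp),
    setIntegral_eq_integral_of_eq_zero
      (fun y hy => by rw [eq_zero_of_notMem_of_tsupport hs hy, mul_zero])]
  exact this

theorem HasWeakGradOn.weakGrad_ae_eq {U : Set Plane} (hU : IsOpen U) {f : Plane → ℝ}
    {g : Plane → Plane} (h : HasWeakGradOn U f g) : weakGrad U f =ᵐ[volume.restrict U] g := by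
  have hex : ∃ g, HasWeakGradOn U f g := ⟨g, h⟩
  have : HasWeakGradOn U f (weakGrad U f) := by
    rw [weakGrad, dif_pos hex]
    exact hex.choose_spec
  exact this.ae_eq hU h

/-- Weak gradients pass to dominated pointwise limits. -/
theorem hasWeakGradOn_of_tendsto {U : Set Plane} (hU : IsOpen U)
    {f : ℕ → Plane → ℝ} {g : ℕ → Plane → Plane} {f₀ F : Plane → ℝ} {g₀ : Plane → Plane}
    {G : Plane → ℝ} (h : ∀ n, HasWeakGradOn U (f n) (g n))
    (hF : IntegrableOn F U volume) (hG : IntegrableOn G U volume)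
    (hfm : ∀ n, AEStronglyMeasurable (f n) (volume.restrict U))
    (hgm : ∀ n, AEStronglyMeasurable (g n) (volume.restrict U))
    (hfF : ∀ n, ∀ y ∈ U, |f n y| ≤ F y) (hgG : ∀ n, ∀ y ∈ U, ‖g n y‖ ≤ G y)
    (hf : ∀ y ∈ U, Tendsto (fun n => f n y) atTop (𝓝 (f₀ y)))
    (hg : ∀ y ∈ U, Tendsto (fun n => g n y) atTop (𝓝 (g₀ y))) :
    HasWeakGradOn U f₀ g₀ := by
  have hUm := hU.measurableSet
  have hf₀ : IntegrableOn f₀ U volume := by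
    refine Integrable.mono' hF (aestronglyMeasurable_of_tendsto_ae atTop hfm ?_) ?_
    · exact (ae_restrict_iff' hUm).2 (ae_of_all _ hf)
    · refine (ae_restrict_iff' hUm).2 (ae_of_all _ fun y hy => ?_)
      exact le_of_tendsto (hf y hy).norm (Eventually.of_forall fun n => hfF n y hy)
  have hg₀ : IntegrableOn g₀ U volume := by
    refine Integrable.mono' hG (aestronglyMeasurable_of_tendsto_ae atTop hgm ?_) ?_
    · exact (ae_restrict_iff' hUm).2 (ae_of_all _ hg)
    · refine (ae_restrict_iff' hUm).2 (ae_of_all _ fun y hy => ?_)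
      exact le_of_tendsto (hg y hy).norm (Eventually.of_forall fun n => hgG n y hy)
  refine ⟨hf₀.locallyIntegrableOn, hg₀.locallyIntegrableOn, fun ψ hψ hc hs v => ?_⟩
  have hψ' : Continuous (fun y => fderiv ℝ ψ y v) :=
    (hψ.continuous_fderiv (by simp)).clm_apply continuous_const
  obtain ⟨C, hC⟩ := hψ.continuous.bounded_above_of_compact_support hc
  obtain ⟨C', hC'⟩ := (hψ.continuous_fderiv (by simp)).bounded_above_of_compact_support
    (hc.fderiv ℝ)
  have l1 : Tendsto (fun n => ∫ y in U, f n y * fderiv ℝ ψ y v) atTop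
      (𝓝 (∫ y in U, f₀ y * fderiv ℝ ψ y v)) := by
    refine tendsto_integral_of_dominated_convergence (fun y => F y * (C' * ‖v‖))
      (fun n => (hfm n).mul hψ'.aestronglyMeasurable) (hF.mul_const _) (fun n => ?_) ?_
    · refine (ae_restrict_iff' hUm).2 (ae_of_all _ fun y hy => ?_)
      rw [norm_mul]
      refine mul_le_mul (hfF n y hy) ?_ (norm_nonneg _) ((abs_nonneg _).trans (hfF n y hy))
      exact ((fderiv ℝ ψ y).le_opNorm v).trans
        (mul_le_mul_of_nonneg_right (hC' y) (norm_nonneg _))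
    · exact (ae_restrict_iff' hUm).2 (ae_of_all _ fun y hy => (hf y hy).mul_const _)
  have l2 : Tendsto (fun n => - ∫ y in U, inner ℝ (g n y) v * ψ y) atTop
      (𝓝 (- ∫ y in U, inner ℝ (g₀ y) v * ψ y)) := by
    refine (tendsto_integral_of_dominated_convergence (fun y => G y * ‖v‖ * C)
      (fun n => ((hgm n).inner aestronglyMeasurable_const).mul
        hψ.continuous.aestronglyMeasurable) ((hG.mul_const _).mul_const _) (fun n => ?_) ?_).neg
    · refine (ae_restrict_iff' hUm).2 (ae_of_all _ fun y hy => ?_)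
      have hG0 : 0 ≤ G y := (norm_nonneg _).trans (hgG n y hy)
      refine (norm_mul_le _ _).trans (mul_le_mul ?_ (hC y) (norm_nonneg _) (by positivity))
      exact (norm_inner_le_norm _ _).trans
        (mul_le_mul_of_nonneg_right (hgG n y hy) (norm_nonneg _))
    · exact (ae_restrict_iff' hUm).2 (ae_of_all _ fun y hy =>
        ((hg y hy).inner tendsto_const_nhds).mul_const _)
  refine tendsto_nhds_unique l1 (l2.congr fun n => ?_)
  exact ((h n).2.2 ψ hψ hc hs v).symm

/-! ### A `C¹` regularisation of the positive part -/

/-- The continuous cut-off that is `0` for `s ≤ ε`, `1` for `s ≥ 2 ε` and affine in between. -/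
def ramp (ε s : ℝ) : ℝ := max 0 (min 1 (s / ε - 1))

/-- The primitive of `ramp ε` vanishing at `0`: a `C¹` approximation of `max s 0` that vanishes
for `s ≤ ε`. -/
def rampInt (ε s : ℝ) : ℝ := ∫ t in (0 : ℝ)..s, ramp ε t

theorem continuous_ramp (ε : ℝ) : Continuous (ramp ε) := by
  unfold ramp; fun_prop

theorem ramp_nonneg (ε s : ℝ) : 0 ≤ ramp ε s := le_max_left _ _

theorem ramp_le_one (ε s : ℝ) : ramp ε s ≤ 1 := max_le zero_le_one (min_le_left _ _)

theorem ramp_eq_zero {ε s : ℝ} (hε : 0 < ε) (hs : s ≤ ε) : ramp ε s = 0 := by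
  have : s / ε ≤ 1 := (div_le_one hε).2 hs
  exact max_eq_left ((min_le_right _ _).trans (by linarith))

theorem ramp_eq_one {ε s : ℝ} (hε : 0 < ε) (hs : 2 * ε ≤ s) : ramp ε s = 1 := by
  have : 2 ≤ s / ε := (le_div_iff₀ hε).2 hs
  rw [ramp, min_eq_left (by linarith), max_eq_right zero_le_one]

theorem hasDerivAt_rampInt (ε s : ℝ) : HasDerivAt (rampInt ε) (ramp ε s) s :=
  (continuous_ramp ε).integral_hasStrictDerivAt 0 s |>.hasDerivAt

theorem contDiff_rampInt (ε : ℝ) : ContDiff ℝ 1 (rampInt ε) := by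
  rw [contDiff_one_iff_deriv]
  refine ⟨fun s => (hasDerivAt_rampInt ε s).differentiableAt, ?_⟩
  rw [show deriv (rampInt ε) = ramp ε from funext fun s => (hasDerivAt_rampInt ε s).deriv]
  exact continuous_ramp ε

theorem rampInt_eq_zero {ε s : ℝ} (hε : 0 < ε) (hs : s ≤ ε) : rampInt ε s = 0 := by
  rw [rampInt]
  apply intervalIntegral.integral_zero_ae
  refine ae_of_all _ fun t ht => ramp_eq_zero hε ?_
  rcases le_total 0 s with h | h
  · rw [uIoc_of_le h] at ht; exact ht.2.trans hs
  · rw [uIoc_of_ge h] at ht; exact ht.2.trans hε.le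

theorem rampInt_nonneg {ε : ℝ} (hε : 0 < ε) (s : ℝ) : 0 ≤ rampInt ε s := by
  rcases le_total s 0 with h | h
  · rw [rampInt_eq_zero hε (h.trans hε.le)]
  · exact intervalIntegral.integral_nonneg h fun t _ => ramp_nonneg ε t

theorem rampInt_le {ε : ℝ} (hε : 0 < ε) (s : ℝ) : rampInt ε s ≤ max s 0 := by
  rcases le_total s 0 with h | h
  · rw [rampInt_eq_zero hε (h.trans hε.le)]; exact le_max_right _ _
  · refine le_trans ?_ (le_max_left _ _)
    calc rampInt ε s ≤ ∫ _ in (0 : ℝ)..s, (1 : ℝ) :=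
          intervalIntegral.integral_mono_on h ((continuous_ramp ε).intervalIntegrable _ _)
            (continuous_const.intervalIntegrable _ _) fun t _ => ramp_le_one ε t
      _ = s := by simp

theorem abs_rampInt_le {ε : ℝ} (hε : 0 < ε) (s : ℝ) : |rampInt ε s| ≤ |s| := by
  rw [abs_of_nonneg (rampInt_nonneg hε s)]
  exact (rampInt_le hε s).trans (max_le (le_abs_self s) (abs_nonneg s))

theorem sub_le_rampInt {ε : ℝ} (hε : 0 < ε) (s : ℝ) : max s 0 - 2 * ε ≤ rampInt ε s := by
  rcases le_total s (2 * ε) with h | h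
  · have : max s 0 ≤ 2 * ε := max_le h (by linarith)
    linarith [rampInt_nonneg hε s]
  · have h0 : 0 ≤ s := by linarith
    rw [max_eq_left h0, rampInt, ← intervalIntegral.integral_add_adjacent_intervals
      ((continuous_ramp ε).intervalIntegrable 0 (2 * ε))
      ((continuous_ramp ε).intervalIntegrable (2 * ε) s)]
    have h1 : 0 ≤ ∫ t in (0 : ℝ)..(2 * ε), ramp ε t :=
      intervalIntegral.integral_nonneg (by linarith) fun t _ => ramp_nonneg ε t
    have h2 : ∫ t in (2 * ε)..s, ramp ε t = s - 2 * ε := by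
      rw [intervalIntegral.integral_congr (g := fun _ => (1 : ℝ))]
      · simp
      · intro t ht
        rw [uIcc_of_le h] at ht
        exact ramp_eq_one hε ht.1
    linarith

/-- The scale `1 / (n + 1)` of the `n`-th regularisation. -/
def scale (n : ℕ) : ℝ := 1 / ((n : ℝ) + 1)

theorem scale_pos (n : ℕ) : 0 < scale n := Nat.one_div_pos_of_nat

theorem tendsto_scale : Tendsto scale atTop (𝓝 0) := tendsto_one_div_add_atTop_nhds_zero_nat

theorem tendsto_rampInt_scale (s : ℝ) :
    Tendsto (fun n => rampInt (scale n) s) atTop (𝓝 (max s 0)) := by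
  have h : Tendsto (fun n => max s 0 - 2 * scale n) atTop (𝓝 (max s 0)) := by
    simpa using tendsto_const_nhds.sub (tendsto_scale.const_mul 2)
  exact tendsto_of_tendsto_of_tendsto_of_le_of_le h tendsto_const_nhds
    (fun n => sub_le_rampInt (scale_pos n) s) (fun n => rampInt_le (scale_pos n) s)

theorem tendsto_ramp_scale (s : ℝ) :
    Tendsto (fun n => ramp (scale n) s) atTop (𝓝 (if 0 < s then 1 else 0)) := by
  split_ifs with h
  · refine tendsto_const_nhds.congr' ?_
    have : Tendsto (fun n => 2 * scale n) atTop (𝓝 0) := by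
      simpa using tendsto_scale.const_mul 2
    filter_upwards [this.eventually_lt_const h] with n hn
    exact (ramp_eq_one (scale_pos n) hn.le).symm
  · refine tendsto_const_nhds.congr fun n => ?_
    exact (ramp_eq_zero (scale_pos n) ((not_lt.1 h).trans (scale_pos n).le)).symm

/-! ### A one-dimensional Wirtinger inequality -/

section Wirtinger

variable {α β t₀ : ℝ} {w w' : ℝ → ℝ}

/-- The `C¹` form of the Wirtinger inequality: `rampInt ε ∘ w` satisfies it on compact
subintervals, with the constant given by the measure `ℓ` of `{w > 0}`. -/
theorem integral_rampInt_sq_le (hw : ContinuousOn w (Ioo α β))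
    (hd : ∀ t ∈ Ioo α β, 0 < w t → HasDerivAt w (w' t) t)
    (hw' : ContinuousOn w' (Ioo α β ∩ {t | 0 < w t}))
    (ht₀ : t₀ ∈ Ioo α β) (hwt₀ : w t₀ ≤ 0) {ℓ : ℝ} (hℓ0 : 0 < ℓ)
    (hℓ : volume (Ioo α β ∩ {t | 0 < w t}) ≤ ENNReal.ofReal ℓ) {ε : ℝ} (hε : 0 < ε)
    {c d : ℝ} (hc : c ∈ Ioo α t₀) (hd' : d ∈ Ioo t₀ β) :
    ContinuousOn (fun t => ramp ε (w t) * w' t) (Ioo α β) ∧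
    (Real.pi / (2 * ℓ)) ^ 2 * ∫ t in c..d, rampInt ε (w t) ^ 2 ≤
      ∫ t in c..d, (ramp ε (w t) * w' t) ^ 2 := by
  set k := Real.pi / (2 * ℓ) with hk
  have hkpos : 0 < k := by positivity
  have hkl : k * ℓ = Real.pi / 2 := by rw [hk]; field_simp
  have hnhds : ∀ t ∈ Ioo α β, Ioo α β ∈ 𝓝 t := fun t ht => isOpen_Ioo.mem_nhds ht
  have hwat : ∀ t ∈ Ioo α β, ContinuousAt w t := fun t ht => hw.continuousAt (hnhds t ht)
  -- near a point with `w ≤ 0` the regularised function vanishes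
  have hzero : ∀ t ∈ Ioo α β, w t ≤ 0 → ∀ᶠ s in 𝓝 t, w s < ε := fun t ht h0 =>
    (hwat t ht).eventually_lt_const (h0.trans_lt hε)
  have hv'c : ContinuousOn (fun t => ramp ε (w t) * w' t) (Ioo α β) := by
    intro t ht
    refine ContinuousAt.continuousWithinAt ?_
    rcases lt_or_ge 0 (w t) with h | h
    · have hmem : Ioo α β ∩ {t | 0 < w t} ∈ 𝓝 t :=
        inter_mem (hnhds t ht) ((hwat t ht).eventually_const_lt h)
      exact ((continuous_ramp ε).continuousAt.comp (hwat t ht)).mul (hw'.continuousAt hmem)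
    · refine (continuousAt_const (y := (0 : ℝ))).congr ?_
      filter_upwards [hzero t ht h] with s hs
      rw [ramp_eq_zero hε hs.le, zero_mul]
  refine ⟨hv'c, ?_⟩
  have hvd : ∀ t ∈ Ioo α β, HasDerivAt (fun t => rampInt ε (w t)) (ramp ε (w t) * w' t) t := by
    intro t ht
    rcases lt_or_ge 0 (w t) with h | h
    · exact (hasDerivAt_rampInt ε (w t)).comp t (hd t ht h)
    · rw [ramp_eq_zero hε (h.trans hε.le), zero_mul]
      refine (hasDerivAt_const t (0 : ℝ)).congr_of_eventuallyEq ?_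
      filter_upwards [hzero t ht h] with s hs
      exact rampInt_eq_zero hε hs.le
  have hvc : ContinuousOn (fun t => rampInt ε (w t)) (Ioo α β) := fun t ht =>
    (hvd t ht).continuousAt.continuousWithinAt
  -- the density of the reparametrisation by the measure of `{w > 0}`
  set h : ℝ → ℝ := fun t => min 1 (max (w t) 0 / ε) with hh
  have hhc : ContinuousOn h (Ioo α β) := by
    have : Continuous fun s : ℝ => min 1 (max s 0 / ε) := by fun_prop
    exact this.comp_continuousOn hw
  have hh0 : ∀ t, 0 ≤ h t := fun t => le_min zero_le_one (by positivity)
  have hh1 : ∀ t, h t ≤ 1 := fun t => min_le_left _ _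
  have hhz : ∀ t, w t ≤ 0 → h t = 0 := fun t ht => by simp [hh, max_eq_right ht]
  have hhone : ∀ t, ε ≤ w t → h t = 1 := fun t ht => by
    rw [hh]
    refine min_eq_left ?_
    rw [max_eq_left (hε.le.trans ht)]
    exact (one_le_div hε).2 ht
  have hhpos : ∀ t, 0 < w t → 0 < h t := fun t ht =>
    lt_min one_pos (div_pos (lt_max_of_lt_left ht) hε)
  have huIcc : ∀ a ∈ Ioo α β, ∀ b ∈ Ioo α β, uIcc a b ⊆ Ioo α β := fun a ha b hb =>
    ordConnected_Ioo.uIcc_subset ha hb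
  have hhi : ∀ a ∈ Ioo α β, ∀ b ∈ Ioo α β, IntervalIntegrable h volume a b := fun a ha b hb =>
    (hhc.mono (huIcc a ha b hb)).intervalIntegrable
  have hhle : ∀ a ∈ Ioo α β, ∀ b ∈ Ioo α β, a ≤ b → ∫ s in a..b, h s ≤ ℓ := by
    intro a ha b hb hab
    rw [intervalIntegral.integral_of_le hab]
    have hsub : Ioc a b ⊆ Ioo α β := fun s hs => ⟨ha.1.trans hs.1, hs.2.trans_lt hb.2⟩
    have e1 : ENNReal.ofReal (∫ s in Ioc a b, h s) ≤ ENNReal.ofReal ℓ := by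
      rw [ofReal_integral_eq_lintegral_ofReal
        ((intervalIntegrable_iff_integrableOn_Ioc_of_le hab).1 (hhi a ha b hb))
        (ae_of_all _ hh0)]
      refine le_trans ?_ hℓ
      have hop : IsOpen (Ioo α β ∩ {t | 0 < w t}) := by
        have := hw.isOpen_inter_preimage isOpen_Ioo (isOpen_Ioi (a := (0 : ℝ)))
        exact this
      rw [← setLIntegral_one, ← lintegral_indicator hop.measurableSet,
        ← lintegral_indicator measurableSet_Ioc]
      refine lintegral_mono fun s => ?_
      by_cases hs : s ∈ Ioc a b
      · rw [indicator_of_mem hs]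
        rcases lt_or_ge 0 (w s) with hp | hp
        · rw [indicator_of_mem (show s ∈ Ioo α β ∩ {t | 0 < w t} from ⟨hsub hs, hp⟩)]
          exact ENNReal.ofReal_le_one.2 (hh1 s)
        · rw [hhz s hp]; simp
      · rw [indicator_of_notMem hs]; exact bot_le
    exact (ENNReal.ofReal_le_ofReal_iff hℓ0.le).1 e1
  -- signed, so that one function serves both sides of `t₀`
  set m : ℝ → ℝ := fun t => ∫ s in t₀..t, h s with hm
  have hmd : ∀ t ∈ Ioo α β, HasDerivAt m (h t) t := fun t ht =>
    intervalIntegral.integral_hasDerivAt_right (hhi t₀ ht₀ t ht)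
      (hhc.stronglyMeasurableAtFilter isOpen_Ioo t ht) (hhc.continuousAt (hnhds t ht))
  have hmpos : ∀ t ∈ Ioo α β, t₀ ≤ t → 0 ≤ m t ∧ m t ≤ ℓ := fun t ht h0 =>
    ⟨intervalIntegral.integral_nonneg h0 fun s _ => hh0 s, hhle t₀ ht₀ t ht h0⟩
  have hmneg : ∀ t ∈ Ioo α β, t ≤ t₀ → m t ≤ 0 ∧ -ℓ ≤ m t := by
    intro t ht h0
    have e : m t = - ∫ s in t..t₀, h s := intervalIntegral.integral_symm _ _
    have e1 : 0 ≤ ∫ s in t..t₀, h s := intervalIntegral.integral_nonneg h0 fun s _ => hh0 s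
    have e2 := hhle t ht t₀ ht₀ h0
    constructor <;> linarith
  have hmabs : ∀ t ∈ Ioo α β, -ℓ ≤ m t ∧ m t ≤ ℓ := by
    intro t ht
    rcases le_total t₀ t with h0 | h0
    · have := hmpos t ht h0
      constructor <;> linarith
    · have := hmneg t ht h0
      constructor <;> linarith
  have hmne : ∀ t ∈ Ioo α β, 0 < w t → m t ≠ 0 := by
    intro t ht hp hm0
    have hne : t ≠ t₀ := by rintro rfl; linarith
    have hcont : ContinuousOn h (uIcc t₀ t) := hhc.mono (huIcc t₀ ht₀ t ht)
    rcases lt_or_gt_of_ne hne with hlt | hlt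
    · have : 0 < ∫ s in t..t₀, h s := by
        refine intervalIntegral.integral_pos hlt (by rwa [uIcc_of_ge hlt.le] at hcont)
          (fun s _ => hh0 s) ⟨t, left_mem_Icc.2 hlt.le, hhpos t hp⟩
      have e : m t = - ∫ s in t..t₀, h s := intervalIntegral.integral_symm _ _
      linarith
    · have : 0 < ∫ s in t₀..t, h s := by
        refine intervalIntegral.integral_pos hlt (by rwa [uIcc_of_le hlt.le] at hcont)
          (fun s _ => hh0 s) ⟨t, right_mem_Icc.2 hlt.le, hhpos t hp⟩
      exact this.ne' hm0
  have hcos : ∀ t ∈ Ioo α β, 0 ≤ Real.cos (k * m t) := by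
    intro t ht
    obtain ⟨h1, h2⟩ := hmabs t ht
    refine Real.cos_nonneg_of_neg_pi_div_two_le_of_le ?_ ?_
    · rw [← hkl]; nlinarith
    · rw [← hkl]; nlinarith
  have hsin : ∀ t ∈ Ioo α β, 0 < w t → Real.sin (k * m t) ≠ 0 := by
    intro t ht hp
    obtain ⟨h1, h2⟩ := hmabs t ht
    have hpi := Real.pi_pos
    intro h0
    have e1 : k * m t ≤ Real.pi / 2 := by rw [← hkl]; nlinarith
    have e2 : -(Real.pi / 2) ≤ k * m t := by rw [← hkl]; nlinarith
    rcases lt_or_gt_of_ne (hmne t ht hp) with hlt | hlt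
    · have : k * m t < 0 := by nlinarith
      have := Real.sin_neg_of_neg_of_neg_pi_lt this (by linarith)
      exact this.ne h0
    · have : 0 < k * m t := by positivity
      exact (Real.sin_pos_of_pos_of_lt_pi this (by linarith)).ne' h0
  -- the Picone-type function whose derivative is dominated by `v' ^ 2 - k ^ 2 * v ^ 2`
  set F : ℝ → ℝ := fun t => rampInt ε (w t) ^ 2 * k * (Real.cos (k * m t) / Real.sin (k * m t))
    with hF
  have hFd : ∀ t ∈ Ioo α β, ∃ F', HasDerivAt F F' t ∧
      F' ≤ (ramp ε (w t) * w' t) ^ 2 - k ^ 2 * rampInt ε (w t) ^ 2 := by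
    intro t ht
    rcases lt_or_ge 0 (w t) with hp | hp
    · have hs := hsin t ht hp
      have d1 : HasDerivAt (fun s => k * m s) (k * h t) t := (hmd t ht).const_mul k
      have d2 := ((((hvd t ht).pow 2).mul_const k).mul (d1.cos.div d1.sin hs))
      refine ⟨_, d2, ?_⟩
      have hsc : Real.cos (k * m t) ^ 2 = 1 - Real.sin (k * m t) ^ 2 := by
        rw [← Real.sin_sq_add_cos_sq (k * m t)]; ring
      rcases le_total (w t) ε with hle | hle
      · simp [ramp_eq_zero hε hle, rampInt_eq_zero hε hle]
      · rw [hhone t hle]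
        set S := Real.sin (k * m t)
        set C := Real.cos (k * m t)
        set v := rampInt ε (w t)
        set v' := ramp ε (w t) * w' t
        have : v' ^ 2 - k ^ 2 * v ^ 2 - (2 * v * v' * k * (C / S)
            + v ^ 2 * k * ((-S * k * S - C * (C * k)) / S ^ 2)) = (v' - v * k * (C / S)) ^ 2 := by
          have hS2 : S ^ 2 ≠ 0 := pow_ne_zero 2 hs
          field_simp
          ring_nf
        have h2 := sq_nonneg (v' - v * k * (C / S))
        norm_num
        norm_num at this
        linarith
    · refine ⟨0, ?_, ?_⟩
      · refine (hasDerivAt_const t (0 : ℝ)).congr_of_eventuallyEq ?_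
        filter_upwards [hzero t ht hp] with s hs
        simp [hF, rampInt_eq_zero hε hs.le]
      · simp [ramp_eq_zero hε (hp.trans hε.le), rampInt_eq_zero hε (hp.trans hε.le)]
  choose! F' hF' hF'le using hFd
  have hcm : c ∈ Ioo α β := ⟨hc.1, hc.2.trans ht₀.2⟩
  have hdm : d ∈ Ioo α β := ⟨ht₀.1.trans hd'.1, hd'.2⟩
  have hcd : c ≤ d := (hc.2.trans hd'.1).le
  have hsub : Icc c d ⊆ Ioo α β := fun s hs => ⟨hc.1.trans_le hs.1, hs.2.trans_lt hd'.2⟩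
  have hi1 : IntervalIntegrable (fun t => (ramp ε (w t) * w' t) ^ 2) volume c d :=
    ((hv'c.pow 2).mono (huIcc c hcm d hdm)).intervalIntegrable
  have hi2 : IntervalIntegrable (fun t => k ^ 2 * rampInt ε (w t) ^ 2) volume c d :=
    ((continuousOn_const.mul (hvc.pow 2)).mono (huIcc c hcm d hdm)).intervalIntegrable
  have key : F d - F c ≤ ∫ t in c..d,
      ((ramp ε (w t) * w' t) ^ 2 - k ^ 2 * rampInt ε (w t) ^ 2) := by
    refine intervalIntegral.sub_le_integral_of_hasDeriv_right_of_le hcd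
      (fun t ht => (hF' t (hsub ht)).continuousAt.continuousWithinAt)
      (fun t ht => (hF' t (hsub (Ioo_subset_Icc_self ht))).hasDerivWithinAt) ?_
      (fun t ht => hF'le t (hsub (Ioo_subset_Icc_self ht)))
    exact (intervalIntegrable_iff_integrableOn_Icc_of_le hcd).1 (hi1.sub hi2)
  have hFd0 : 0 ≤ F d := by
    have h1 := hmpos d hdm hd'.1.le
    have : 0 ≤ Real.sin (k * m d) :=
      Real.sin_nonneg_of_nonneg_of_le_pi (mul_nonneg hkpos.le h1.1)
        (by have := Real.pi_pos; nlinarith)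
    have := hcos d hdm
    rw [hF]; positivity
  have hFc0 : F c ≤ 0 := by
    have h1 := hmneg c hcm hc.2.le
    have : Real.sin (k * m c) ≤ 0 :=
      Real.sin_nonpos_of_nonpos_of_neg_pi_le (mul_nonpos_of_nonneg_of_nonpos hkpos.le h1.1)
        (by have := Real.pi_pos; nlinarith)
    have h2 := hcos c hcm
    exact mul_nonpos_of_nonneg_of_nonpos (by positivity) (div_nonpos_of_nonneg_of_nonpos h2 this)
  rw [intervalIntegral.integral_sub hi1 hi2, intervalIntegral.integral_const_mul] at key
  linarith

/-- **Wirtinger's inequality** on the positivity set: if a function on an interval has a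
non-positive value, then `∫ (w⁺)² ≤ (2 ℓ / π)² ∫_{w > 0} (w')²`, where `ℓ` bounds the measure of
`{w > 0}`. Nothing is required at the end points of the interval, and `w` need only be
differentiable where it is positive. -/
theorem lintegral_sq_le_of_nonpos (hw : ContinuousOn w (Ioo α β))
    (hd : ∀ t ∈ Ioo α β, 0 < w t → HasDerivAt w (w' t) t)
    (hw' : ContinuousOn w' (Ioo α β ∩ {t | 0 < w t}))
    (ht₀ : t₀ ∈ Ioo α β) (hwt₀ : w t₀ ≤ 0) {ℓ : ℝ} (hℓ0 : 0 < ℓ)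
    (hℓ : volume (Ioo α β ∩ {t | 0 < w t}) ≤ ENNReal.ofReal ℓ) :
    ∫⁻ t in Ioo α β ∩ {t | 0 < w t}, ENNReal.ofReal (w t ^ 2) ≤
      ENNReal.ofReal ((2 * ℓ / Real.pi) ^ 2) *
        ∫⁻ t in Ioo α β ∩ {t | 0 < w t}, ENNReal.ofReal (w' t ^ 2) := by
  have hop : IsOpen (Ioo α β ∩ {t | 0 < w t}) :=
    hw.isOpen_inter_preimage isOpen_Ioo (isOpen_Ioi (a := (0 : ℝ)))
  set K := ENNReal.ofReal ((2 * ℓ / Real.pi) ^ 2) *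
        ∫⁻ t in Ioo α β ∩ {t | 0 < w t}, ENNReal.ofReal (w' t ^ 2) with hK
  have hpi := Real.pi_pos
  -- the inequality for the regularisation on a compact subinterval
  have h1 : ∀ n : ℕ, ∀ c ∈ Ioo α t₀, ∀ d ∈ Ioo t₀ β,
      ∫⁻ t in Icc c d, ENNReal.ofReal (rampInt (scale n) (w t) ^ 2) ≤ K := by
    intro n c hc d hd'
    have hcm : c ∈ Ioo α β := ⟨hc.1, hc.2.trans ht₀.2⟩
    have hdm : d ∈ Ioo α β := ⟨ht₀.1.trans hd'.1, hd'.2⟩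
    have hcd : c ≤ d := (hc.2.trans hd'.1).le
    have hsub : Icc c d ⊆ Ioo α β := fun s hs => ⟨hc.1.trans_le hs.1, hs.2.trans_lt hd'.2⟩
    obtain ⟨hv', h2⟩ := integral_rampInt_sq_le hw hd hw' ht₀ hwt₀ hℓ0 hℓ (scale_pos n) hc hd'
    rw [intervalIntegral.integral_of_le hcd, intervalIntegral.integral_of_le hcd,
      ← integral_Icc_eq_integral_Ioc, ← integral_Icc_eq_integral_Ioc] at h2
    have i1 : IntegrableOn (fun t => rampInt (scale n) (w t) ^ 2) (Icc c d) :=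
      ((((contDiff_rampInt _).continuous.comp_continuousOn hw).pow 2).mono
        hsub).integrableOn_compact isCompact_Icc
    have i2 : IntegrableOn (fun t => (ramp (scale n) (w t) * w' t) ^ 2) (Icc c d) :=
      ((hv'.pow 2).mono hsub).integrableOn_compact isCompact_Icc
    rw [← ofReal_integral_eq_lintegral_ofReal i1 (ae_of_all _ fun t => sq_nonneg _)]
    have h3 : ∫ t in Icc c d, rampInt (scale n) (w t) ^ 2 ≤
        (2 * ℓ / Real.pi) ^ 2 * ∫ t in Icc c d, (ramp (scale n) (w t) * w' t) ^ 2 := by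
      have h4 : (2 * ℓ / Real.pi) ^ 2 * (Real.pi / (2 * ℓ)) ^ 2 = 1 := by field_simp
      have h5 := mul_le_mul_of_nonneg_left h2 (sq_nonneg (2 * ℓ / Real.pi))
      rwa [← mul_assoc, h4, one_mul] at h5
    refine (ENNReal.ofReal_le_ofReal h3).trans ?_
    rw [ENNReal.ofReal_mul (sq_nonneg _),
      ofReal_integral_eq_lintegral_ofReal i2 (ae_of_all _ fun t => sq_nonneg _), hK]
    refine mul_le_mul' le_rfl ?_
    rw [← lintegral_indicator hop.measurableSet, ← lintegral_indicator measurableSet_Icc]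
    refine lintegral_mono fun s => ?_
    by_cases hs : s ∈ Icc c d
    · rw [indicator_of_mem hs]
      rcases lt_or_ge 0 (w s) with hp | hp
      · rw [indicator_of_mem (show s ∈ Ioo α β ∩ {t | 0 < w t} from ⟨hsub hs, hp⟩)]
        refine ENNReal.ofReal_le_ofReal ?_
        rw [mul_pow]
        have e1 := ramp_nonneg (scale n) (w s)
        have e2 := ramp_le_one (scale n) (w s)
        have e3 : ramp (scale n) (w s) ^ 2 ≤ 1 := pow_le_one₀ e1 e2
        nlinarith [sq_nonneg (w' s)]
      · rw [ramp_eq_zero (scale_pos n) (hp.trans (scale_pos n).le)]; simp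
    · rw [indicator_of_notMem hs]; exact bot_le
  have h2 : ∀ c ∈ Ioo α t₀, ∀ d ∈ Ioo t₀ β,
      ∫⁻ t in Icc c d, ENNReal.ofReal (max (w t) 0 ^ 2) ≤ K := by
    intro c hc d hd'
    have hsub : Icc c d ⊆ Ioo α β := fun s hs => ⟨hc.1.trans_le hs.1, hs.2.trans_lt hd'.2⟩
    have hlim : ∀ t, Tendsto (fun n => ENNReal.ofReal (rampInt (scale n) (w t) ^ 2)) atTop
        (𝓝 (ENNReal.ofReal (max (w t) 0 ^ 2))) := fun t =>
      (ENNReal.continuous_ofReal.tendsto _).comp ((tendsto_rampInt_scale (w t)).pow 2)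
    calc ∫⁻ t in Icc c d, ENNReal.ofReal (max (w t) 0 ^ 2)
        = ∫⁻ t in Icc c d, liminf (fun n => ENNReal.ofReal (rampInt (scale n) (w t) ^ 2)) atTop :=
          lintegral_congr fun t => (hlim t).liminf_eq.symm
      _ ≤ liminf (fun n =>
            ∫⁻ t in Icc c d, ENNReal.ofReal (rampInt (scale n) (w t) ^ 2)) atTop := by
          refine lintegral_liminf_le' fun n => ?_
          refine ENNReal.measurable_ofReal.comp_aemeasurable ?_
          exact (((((contDiff_rampInt _).continuous.comp_continuousOn hw).pow 2).mono
            hsub).aestronglyMeasurable measurableSet_Icc).aemeasurable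
      _ ≤ K := liminf_le_of_le ⟨0, by simp⟩ fun b hb => by
          obtain ⟨n, hn⟩ := hb.exists
          exact hn.trans (h1 n c hc d hd')
  obtain ⟨a, -, ha, ha'⟩ := exists_seq_strictAnti_tendsto' ht₀.1
  obtain ⟨b, -, hb, hb'⟩ := exists_seq_strictMono_tendsto' ht₀.2
  have hcov := aecover_Ioo_of_Icc (μ := (volume : Measure ℝ)) ha' hb'
  have hmeas : AEMeasurable (fun t => ENNReal.ofReal (max (w t) 0 ^ 2))
      (volume.restrict (Ioo α β)) := by
    refine ENNReal.measurable_ofReal.comp_aemeasurable ?_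
    have : ContinuousOn (fun t => max (w t) 0 ^ 2) (Ioo α β) :=
      (hw.sup continuousOn_const).pow 2
    exact (this.aestronglyMeasurable measurableSet_Ioo).aemeasurable
  have hle : ∫⁻ t in Ioo α β, ENNReal.ofReal (max (w t) 0 ^ 2) ≤ K := by
    refine le_of_tendsto (hcov.lintegral_tendsto_of_countably_generated hmeas)
      (Eventually.of_forall fun n => ?_)
    refine le_trans ?_ (h2 (a n) (ha n) (b n) (hb n))
    exact lintegral_mono' (Measure.restrict_mono' (ae_of_all _ fun _ h => h)
      Measure.restrict_le_self) le_rfl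
  refine le_trans ?_ hle
  calc ∫⁻ t in Ioo α β ∩ {t | 0 < w t}, ENNReal.ofReal (w t ^ 2)
      = ∫⁻ t in Ioo α β ∩ {t | 0 < w t}, ENNReal.ofReal (max (w t) 0 ^ 2) :=
        setLIntegral_congr_fun hop.measurableSet fun t ht => by
          have h : 0 < w t := ht.2
          simp only [max_eq_left h.le]
    _ ≤ _ := lintegral_mono_set inter_subset_left

end Wirtinger

section

/-! ### Functions that are `C¹` off their zero set -/

/-- The data on `u` that enter the monotonicity formula on `D ⊆ B_R(x) \ {x}`: `u` is continuous
on `D`, `C¹` off its zero set, `u` and its classical gradient off `{u = 0}` are square integrable,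
and `∇u` is orthogonal to the gradients of all `C¹` test functions of class `H¹` that vanish near
`∂B_R(x)` and near `{u = 0}`. The value of `gradient u` at a zero of `u` plays no role in the last
condition, the test function being locally `0` there. The conditions are invariant under
`u ↦ -u`. -/
structure Admissible (D : Set Plane) (x : Plane) (R : ℝ) (u : Plane → ℝ) : Prop where
  isOpen : IsOpen D
  subset_ball : D ⊆ Metric.ball x R
  center_notMem : x ∉ D
  continuousOn : ContinuousOn u D
  contDiffAt : ∀ y ∈ D, u y ≠ 0 → ContDiffAt ℝ 1 u y
  memLp : MemLp u 2 (volume.restrict D)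
  memLp_gradient : MemLp ((D ∩ {y | u y ≠ 0}).indicator (gradient u)) 2 (volume.restrict D)
  weak : ∀ φ : Plane → ℝ, ContDiffOn ℝ 1 φ D → MemLp φ 2 (volume.restrict D) →
    MemLp (gradient φ) 2 (volume.restrict D) →
    (∃ r' < R, ∀ y ∈ D, r' ≤ dist y x → φ y = 0) →
    (∃ ε > 0, ∀ y ∈ D, |u y| < ε → φ y = 0) →
    ∫ y in D, inner ℝ (gradient u y) (gradient φ y) = 0

theorem gradient_fun_neg (f : Plane → ℝ) : gradient (fun y => -f y) = fun y => -gradient f y := by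
  funext y
  rw [gradient, gradient, fderiv_fun_neg, map_neg]

variable {D : Set Plane} {x : Plane} {R : ℝ} {u : Plane → ℝ}

theorem Admissible.neg (h : Admissible D x R u) : Admissible D x R (fun y => -u y) where
  isOpen := h.isOpen
  subset_ball := h.subset_ball
  center_notMem := h.center_notMem
  continuousOn := h.continuousOn.neg
  contDiffAt y hy hu := (h.contDiffAt y hy (neg_ne_zero.1 hu)).neg
  memLp := h.memLp.neg
  memLp_gradient := by
    have : (D ∩ {y | -u y ≠ 0}).indicator (gradient fun y => -u y) =
        -(D ∩ {y | u y ≠ 0}).indicator (gradient u) := by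
      rw [gradient_fun_neg]
      simp only [ne_eq, neg_eq_zero]
      exact indicator_neg _ _
    rw [this]
    exact h.memLp_gradient.neg
  weak φ h1 h2 h3 h4 h5 := by
    have := h.weak φ h1 h2 h3 h4 (by simpa only [abs_neg] using h5)
    rw [gradient_fun_neg]
    simp only [inner_neg_left, integral_neg, this, neg_zero]

/-- The positivity set `{u > 0} ∩ D`. -/
def posSet (D : Set Plane) (u : Plane → ℝ) : Set Plane := D ∩ {y | 0 < u y}

/-- The energy density `|∇u⁺|²`, written with the classical gradient on `{u > 0}`. -/
def density (D : Set Plane) (u : Plane → ℝ) : Plane → ℝ :=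
  (posSet D u).indicator fun y => ‖gradient u y‖ ^ 2

/-- The flux density `u⁺ ∂_r u⁺`, where `∂_r` is the radial derivative at `x`. -/
def flux (D : Set Plane) (x : Plane) (u : Plane → ℝ) : Plane → ℝ :=
  (posSet D u).indicator fun y => u y * inner ℝ (gradient u y) (‖y - x‖⁻¹ • (y - x))

/-- The function `(u⁺)²`. -/
def posSq (D : Set Plane) (u : Plane → ℝ) : Plane → ℝ := (posSet D u).indicator fun y => u y ^ 2

namespace Admissible

theorem isOpen_posSet (h : Admissible D x R u) : IsOpen (posSet D u) :=
  h.continuousOn.isOpen_inter_preimage h.isOpen (isOpen_Ioi (a := (0 : ℝ)))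

theorem continuousAt (h : Admissible D x R u) {y : Plane} (hy : y ∈ D) : ContinuousAt u y :=
  h.continuousOn.continuousAt (h.isOpen.mem_nhds hy)

theorem eventually_abs_lt (h : Admissible D x R u) {y : Plane} (hy : y ∈ D) (hu : u y = 0)
    {ε : ℝ} (hε : 0 < ε) : ∀ᶠ z in 𝓝 y, |u z| < ε := by
  have : ContinuousAt (fun z => |u z|) y := (h.continuousAt hy).abs
  exact this.eventually_lt_const (by simpa [hu] using hε)

theorem continuousOn_gradient_posSet (h : Admissible D x R u) :
    ContinuousOn (gradient u) (posSet D u) :=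
  continuousOn_gradient h.isOpen_posSet fun y hy =>
    (h.contDiffAt y hy.1 (ne_of_gt hy.2)).contDiffWithinAt

theorem volume_lt_top (h : Admissible D x R u) : volume D < ⊤ :=
  (measure_mono h.subset_ball).trans_lt measure_ball_lt_top

theorem isFiniteMeasure (h : Admissible D x R u) : IsFiniteMeasure (volume.restrict D) :=
  ⟨by simpa using h.volume_lt_top⟩

/-- The classical gradient on the positivity set, extended by zero, is square integrable. -/
theorem memLp_posSet (h : Admissible D x R u) :
    MemLp ((posSet D u).indicator (gradient u)) 2 (volume.restrict D) := by
  have : (posSet D u).indicator (gradient u) =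
      (posSet D u).indicator ((D ∩ {y | u y ≠ 0}).indicator (gradient u)) := by
    rw [indicator_indicator]
    congr 1
    ext y
    simp only [posSet, mem_inter_iff, mem_ofPred_eq, ne_eq]
    exact ⟨fun hy => ⟨hy, hy.1, ne_of_gt hy.2⟩, fun hy => hy.1⟩
  rw [this]
  exact h.memLp_gradient.indicator h.isOpen_posSet.measurableSet

theorem norm_ramp_smul_gradient_le (ε : ℝ) (hε : 0 < ε) {y : Plane} (hy : y ∈ D) :
    ‖ramp ε (u y) • gradient u y‖ ≤ ‖(posSet D u).indicator (gradient u) y‖ := by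
  rcases lt_or_ge 0 (u y) with hp | hp
  · rw [indicator_of_mem (show y ∈ posSet D u from ⟨hy, hp⟩), norm_smul,
      Real.norm_of_nonneg (ramp_nonneg _ _)]
    exact mul_le_of_le_one_left (norm_nonneg _) (ramp_le_one _ _)
  · rw [ramp_eq_zero hε (hp.trans hε.le), zero_smul, norm_zero]
    exact norm_nonneg _

theorem tendsto_ramp_smul_gradient {y : Plane} (hy : y ∈ D) :
    Tendsto (fun n => ramp (scale n) (u y) • gradient u y) atTop
      (𝓝 ((posSet D u).indicator (gradient u) y)) := by
  have := (tendsto_ramp_scale (u y)).smul_const (gradient u y)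
  convert this using 2
  by_cases hp : 0 < u y
  · rw [indicator_of_mem (show y ∈ posSet D u from ⟨hy, hp⟩), if_pos hp, one_smul]
  · rw [indicator_of_notMem (fun h => hp h.2), if_neg hp, zero_smul]

/-- Multiplying the regularised positive part by a function that is `C¹` on `D` gives a `C¹`
function, with the gradient expected from the product and chain rules. -/
theorem rampInt_mul (h : Admissible D x R u) {ε : ℝ} (hε : 0 < ε) {η : Plane → ℝ}
    (hη : ∀ y ∈ D, ContDiffAt ℝ 1 η y) :
    ContDiffOn ℝ 1 (fun y => rampInt ε (u y) * η y) D ∧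
    ∀ y ∈ D, gradient (fun y => rampInt ε (u y) * η y) y =
      η y • ramp ε (u y) • gradient u y + rampInt ε (u y) • gradient η y := by
  have hz : ∀ y ∈ D, u y = 0 →
      (fun y => rampInt ε (u y) * η y) =ᶠ[𝓝 y] fun _ => 0 := by
    intro y hy hu
    filter_upwards [h.eventually_abs_lt hy hu hε] with z hz
    rw [rampInt_eq_zero hε ((le_abs_self _).trans hz.le), zero_mul]
  constructor
  · intro y hy
    refine ContDiffAt.contDiffWithinAt ?_
    by_cases hu : u y = 0
    · exact contDiffAt_const.congr_of_eventuallyEq (hz y hy hu)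
    · exact ((contDiff_rampInt ε).contDiffAt.comp y (h.contDiffAt y hy hu)).mul (hη y hy)
  · intro y hy
    by_cases hu : u y = 0
    · rw [hu, ramp_eq_zero hε hε.le, rampInt_eq_zero hε hε.le, gradient, (hz y hy hu).fderiv_eq]
      simp
    · have d1 : HasFDerivAt u (fderiv ℝ u y) y :=
        ((h.contDiffAt y hy hu).differentiableAt (by simp)).hasFDerivAt
      have d2 : HasFDerivAt η (fderiv ℝ η y) y :=
        ((hη y hy).differentiableAt (by simp)).hasFDerivAt
      have d3 := ((hasDerivAt_rampInt ε (u y)).comp_hasFDerivAt y d1).mul d2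
      refine ext_inner_right ℝ fun v => ?_
      rw [inner_gradient_left]
      have e : (fun y => rampInt ε (u y) * η y) = (rampInt ε ∘ u) * η := rfl
      rw [e, d3.fderiv]
      simp only [inner_add_left, inner_smul_left, inner_gradient_left]
      simp
      ring

/-- The positive part has the weak gradient `1_{u > 0} ∇u`. -/
theorem hasWeakGradOn_posPt (h : Admissible D x R u) :
    HasWeakGradOn D (posPt u) ((posSet D u).indicator (gradient u)) := by
  have := h.isFiniteMeasure
  have hη : ∀ y ∈ D, ContDiffAt ℝ 1 (fun _ : Plane => (1 : ℝ)) y := fun y _ => contDiffAt_const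
  have h1 : ∀ n, ContDiffOn ℝ 1 (fun y => rampInt (scale n) (u y) * 1) D := fun n =>
    (h.rampInt_mul (scale_pos n) hη).1
  have h2 : ∀ n, ∀ y ∈ D, gradient (fun y => rampInt (scale n) (u y) * 1) y =
      ramp (scale n) (u y) • gradient u y := fun n y hy => by
    have := (h.rampInt_mul (scale_pos n) hη).2 y hy
    have e : gradient (fun _ : Plane => (1 : ℝ)) y = 0 := by simp [gradient]
    rw [this, e, smul_zero, add_zero, one_smul]
  refine hasWeakGradOn_of_tendsto h.isOpen (fun n => hasWeakGradOn_of_contDiffOn h.isOpen (h1 n))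
    (F := fun y => |u y|) (G := fun y => ‖(posSet D u).indicator (gradient u) y‖)
    (h.memLp.integrable one_le_two).abs (h.memLp_posSet.integrable one_le_two).norm
    (fun n => (h1 n).continuousOn.aestronglyMeasurable h.isOpen.measurableSet)
    (fun n => (continuousOn_gradient h.isOpen (h1 n)).aestronglyMeasurable
      h.isOpen.measurableSet) ?_ ?_ ?_ ?_
  · intro n y _
    rw [mul_one]
    exact abs_rampInt_le (scale_pos n) (u y)
  · intro n y hy
    rw [h2 n y hy]
    exact norm_ramp_smul_gradient_le _ (scale_pos n) hy
  · intro y _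
    simpa [posPt] using tendsto_rampInt_scale (u y)
  · intro y hy
    refine (tendsto_ramp_smul_gradient hy).congr fun n => (h2 n y hy).symm

theorem memH1_posPt (h : Admissible D x R u) : MemH1 D (posPt u) := by
  refine ⟨?_, _, h.memLp_posSet, h.hasWeakGradOn_posPt⟩
  refine h.memLp.mono (h.memLp.aestronglyMeasurable.sup aestronglyMeasurable_const)
    (ae_of_all _ fun y => ?_)
  rw [posPt, Real.norm_of_nonneg (le_max_right _ _), Real.norm_eq_abs]
  exact max_le (le_abs_self _) (abs_nonneg _)

theorem integrable_density (h : Admissible D x R u) : Integrable (density D u) := by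
  unfold density
  have h1 : IntegrableOn (fun y => ‖(posSet D u).indicator (gradient u) y‖ ^ 2) D :=
    (memLp_two_iff_integrable_sq_norm h.memLp_posSet.aestronglyMeasurable).1 h.memLp_posSet
  have h2 : (fun y => ‖(posSet D u).indicator (gradient u) y‖ ^ 2) =
      (posSet D u).indicator fun y => ‖gradient u y‖ ^ 2 := by
    funext y
    by_cases hy : y ∈ posSet D u
    · simp [indicator_of_mem hy]
    · simp [indicator_of_notMem hy]
  rw [h2] at h1
  refine (integrableOn_iff_integrable_of_support_subset ?_).1 h1
  exact (support_indicator_subset).trans fun y hy => hy.1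

/-- On open subsets of `D` the Dirichlet energy of `u⁺`, defined through a chosen weak gradient, is
the integral of the classical density. -/
theorem energy_posPt (h : Admissible D x R u) {V : Set Plane} (hV : IsOpen V) (hVD : V ⊆ D) :
    energy V (posPt u) = ∫ y in V, density D u y := by
  rw [energy]
  unfold density
  refine integral_congr_ae ?_
  filter_upwards [(h.hasWeakGradOn_posPt.mono hVD).weakGrad_ae_eq hV] with y hy
  rw [hy]
  by_cases hy : y ∈ posSet D u
  · simp [indicator_of_mem hy]
  · simp [indicator_of_notMem hy]

theorem integrable_posSq (h : Admissible D x R u) :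
    Integrable (posSq D u) := by
  have h1 : IntegrableOn (fun y => u y ^ 2) D :=
    (memLp_two_iff_integrable_sq h.memLp.aestronglyMeasurable).1 h.memLp
  exact (h1.mono_set inter_subset_left).integrable_indicator h.isOpen_posSet.measurableSet

theorem continuousOn_flux (h : Admissible D x R u) : ContinuousOn (fun y =>
    u y * inner ℝ (gradient u y) (‖y - x‖⁻¹ • (y - x))) (posSet D u) := by
  refine (h.continuousOn.mono inter_subset_left).mul (h.continuousOn_gradient_posSet.inner ?_)
  have hc : Continuous fun y : Plane => y - x := by fun_prop
  refine ContinuousOn.smul (ContinuousOn.inv₀ hc.norm.continuousOn fun y hy => ?_)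
    hc.continuousOn
  rw [norm_ne_zero_iff, sub_ne_zero]
  rintro rfl
  exact h.center_notMem hy.1

theorem _root_.ContinuousOn.measurable_indicator {s : Set Plane} {f : Plane → ℝ}
    (hf : ContinuousOn f s) (hs : IsOpen s) : Measurable (s.indicator f) := by
  classical
  rw [← piecewise_eq_indicator]
  exact hf.measurable_piecewise continuousOn_const hs.measurableSet

theorem measurable_density (h : Admissible D x R u) : Measurable (density D u) :=
  (h.continuousOn_gradient_posSet.norm.pow 2).measurable_indicator h.isOpen_posSet

theorem measurable_flux (h : Admissible D x R u) : Measurable (flux D x u) :=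
  h.continuousOn_flux.measurable_indicator h.isOpen_posSet

theorem measurable_posSq (h : Admissible D x R u) : Measurable (posSq D u) :=
  ((h.continuousOn.mono inter_subset_left).pow 2).measurable_indicator h.isOpen_posSet

theorem integrable_flux (h : Admissible D x R u) : Integrable (flux D x u) := by
  refine (h.integrable_posSq.add h.integrable_density).mono'
    h.measurable_flux.aestronglyMeasurable (ae_of_all _ fun y => ?_)
  unfold posSq density flux
  by_cases hy : y ∈ posSet D u
  · rw [Pi.add_apply, indicator_of_mem hy, indicator_of_mem hy, indicator_of_mem hy, norm_mul]
    have e1 : ‖inner ℝ (gradient u y) (‖y - x‖⁻¹ • (y - x))‖ ≤ ‖gradient u y‖ := by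
      refine (norm_inner_le_norm _ _).trans (mul_le_of_le_one_right (norm_nonneg _) ?_)
      rw [norm_smul, norm_inv, norm_norm]
      exact inv_mul_le_one
    have e2 := norm_nonneg (inner ℝ (gradient u y) (‖y - x‖⁻¹ • (y - x)))
    have e3 : ‖u y‖ ^ 2 = u y ^ 2 := by simp
    nlinarith [sq_nonneg (‖u y‖ - ‖inner ℝ (gradient u y) (‖y - x‖⁻¹ • (y - x))‖),
      norm_nonneg (u y), norm_nonneg (gradient u y)]
  · rw [Pi.add_apply, indicator_of_notMem hy, indicator_of_notMem hy, indicator_of_notMem hy]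
    simp

end Admissible

theorem contDiffAt_norm_sub_and_fderiv {y : Plane} (hy : y ≠ x) :
    ContDiffAt ℝ 1 (fun y => ‖y - x‖) y ∧
    ∀ v, fderiv ℝ (fun y => ‖y - x‖) y v = inner ℝ (‖y - x‖⁻¹ • (y - x)) v := by
  have hne : y - x ≠ 0 := sub_ne_zero.2 hy
  have hn : ‖y - x‖ ≠ 0 := norm_ne_zero_iff.2 hne
  refine ⟨(contDiffAt_id.sub contDiffAt_const).norm ℝ hne, fun v => ?_⟩
  have h1 : HasFDerivAt (fun y : Plane => y - x) (ContinuousLinearMap.id ℝ Plane) y :=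
    (hasFDerivAt_id y).sub_const x
  have h2 := h1.norm_sq.sqrt (by positivity)
  have e : (fun y : Plane => √(‖y - x‖ ^ 2)) = fun y => ‖y - x‖ := by
    funext y; exact Real.sqrt_sq (norm_nonneg _)
  rw [e] at h2
  rw [h2.fderiv, Real.sqrt_sq (norm_nonneg _)]
  simp only [inner_smul_left, smul_apply, ContinuousLinearMap.comp_apply,
    ContinuousLinearMap.id_apply, innerSL_apply_apply, smul_eq_mul, nsmul_eq_mul]
  simp
  field_simp

/-- The energy identity against a radial cut-off: test the Neumann condition with
`u⁺ χ(|y - x|)`, regularised. -/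
theorem Admissible.integral_radial_identity (h : Admissible D x R u) {χ : ℝ → ℝ}
    (hχ : ContDiff ℝ 1 χ) {r' : ℝ} (hr' : r' < R) (hχ0 : ∀ s, r' ≤ s → χ s = 0) :
    ∫ y, χ ‖y - x‖ * density D u y = - ∫ y, deriv χ ‖y - x‖ * flux D x u y := by
  unfold density flux
  have hDm := h.isOpen.measurableSet
  have hχ' : Continuous (deriv χ) := hχ.continuous_deriv le_rfl
  have hxD : ∀ y ∈ D, y ≠ x := fun y hy e => h.center_notMem (e ▸ hy)
  obtain ⟨C, hC⟩ := isCompact_Icc.exists_bound_of_continuousOn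
    (s := Icc (0 : ℝ) R) hχ.continuous.continuousOn
  obtain ⟨C', hC'⟩ := isCompact_Icc.exists_bound_of_continuousOn
    (s := Icc (0 : ℝ) R) hχ'.continuousOn
  have hIcc : ∀ y ∈ D, ‖y - x‖ ∈ Icc 0 R := fun y hy =>
    ⟨norm_nonneg _, by have := h.subset_ball hy; rw [mem_ball_iff_norm] at this; exact this.le⟩
  set η : Plane → ℝ := fun y => χ ‖y - x‖ with hηdef
  have hη : ∀ y ∈ D, ContDiffAt ℝ 1 η y := fun y hy =>
    hχ.contDiffAt.comp y (contDiffAt_norm_sub_and_fderiv (hxD y hy)).1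
  have hηg : ∀ y ∈ D, gradient η y = deriv χ ‖y - x‖ • ‖y - x‖⁻¹ • (y - x) := by
    intro y hy
    refine ext_inner_right ℝ fun v => ?_
    have d1 : HasFDerivAt (fun y => ‖y - x‖) (fderiv ℝ (fun y => ‖y - x‖) y) y :=
      ((contDiffAt_norm_sub_and_fderiv (hxD y hy)).1.differentiableAt (by simp)).hasFDerivAt
    have d2 := ((hχ.differentiable (by simp)) ‖y - x‖).hasDerivAt.comp_hasFDerivAt y d1
    rw [inner_gradient_left, show η = χ ∘ fun y => ‖y - x‖ from rfl, d2.fderiv,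
      inner_smul_left]
    simp [(contDiffAt_norm_sub_and_fderiv (hxD y hy)).2 v]
  have hunit : ∀ y : Plane, ‖‖y - x‖⁻¹ • (y - x)‖ ≤ 1 := fun y => by
    rw [norm_smul, norm_inv, norm_norm]; exact inv_mul_le_one
  have hweak : ∀ n : ℕ, ∫ y in D, (χ ‖y - x‖ * inner ℝ (gradient u y)
        (ramp (scale n) (u y) • gradient u y) +
      rampInt (scale n) (u y) * deriv χ ‖y - x‖ *
        inner ℝ (gradient u y) (‖y - x‖⁻¹ • (y - x))) = 0 := by
    intro n
    obtain ⟨h1, h2⟩ := h.rampInt_mul (scale_pos n) hη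
    have h3 : ∀ y ∈ D, ‖η y‖ ≤ C := fun y hy => hC _ (hIcc y hy)
    rw [← h.weak (fun y => rampInt (scale n) (u y) * η y) h1 ?_ ?_ ⟨r', hr', ?_⟩
      ⟨scale n, scale_pos n, ?_⟩]
    · refine setIntegral_congr_fun hDm fun y hy => ?_
      simp only [h2 y hy, hηg y hy, inner_add_right, inner_smul_right]
      ring
    · refine (h.memLp.norm.const_mul C).mono
        (h1.continuousOn.aestronglyMeasurable hDm) ?_
      refine (ae_restrict_iff' hDm).2 (ae_of_all _ fun y hy => ?_)
      rw [norm_mul, norm_mul, norm_norm, mul_comm]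
      exact mul_le_mul ((h3 y hy).trans (le_abs_self C)) (abs_rampInt_le (scale_pos n) _)
        (norm_nonneg _) (norm_nonneg _)
    · refine ((h.memLp_posSet.norm.const_mul C).add (h.memLp.norm.const_mul C')).mono
        ((continuousOn_gradient h.isOpen h1).aestronglyMeasurable hDm) ?_
      refine (ae_restrict_iff' hDm).2 (ae_of_all _ fun y hy => ?_)
      rw [h2 y hy, hηg y hy]
      refine le_trans ?_ (le_abs_self _)
      refine (norm_add_le _ _).trans (add_le_add ?_ ?_)
      · rw [norm_smul]
        exact mul_le_mul (h3 y hy) (norm_ramp_smul_gradient_le _ (scale_pos n) hy) (norm_nonneg _)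
          ((norm_nonneg _).trans (h3 y hy))
      · rw [norm_smul, norm_smul, mul_comm]
        refine mul_le_mul ?_ (abs_rampInt_le (scale_pos n) _) (norm_nonneg _)
          ((norm_nonneg _).trans (hC' _ (hIcc y hy)))
        exact (mul_le_of_le_one_right (norm_nonneg _) (hunit y)).trans (hC' _ (hIcc y hy))
    · intro y _ hyr
      rw [dist_eq_norm] at hyr
      simp [hηdef, hχ0 _ hyr]
    · intro y _ hyu
      rw [rampInt_eq_zero (scale_pos n) ((le_abs_self _).trans hyu.le), zero_mul]
  have i1 : IntegrableOn (fun y => χ ‖y - x‖ *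
      (posSet D u).indicator (fun y => ‖gradient u y‖ ^ 2) y) D := by
    refine (h.integrable_density.integrableOn (s := D)).bdd_mul (c := C)
      (hχ.continuous.comp (by fun_prop : Continuous fun y : Plane => ‖y - x‖)).aestronglyMeasurable
      ((ae_restrict_iff' hDm).2 (ae_of_all _ fun y hy => hC _ (hIcc y hy)))
  have i2 : IntegrableOn (fun y => deriv χ ‖y - x‖ * (posSet D u).indicator (fun y =>
        u y * inner ℝ (gradient u y) (‖y - x‖⁻¹ • (y - x))) y) D := by
    refine (h.integrable_flux.integrableOn (s := D)).bdd_mul (c := C')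
      (hχ'.comp (by fun_prop : Continuous fun y : Plane => ‖y - x‖)).aestronglyMeasurable
      ((ae_restrict_iff' hDm).2 (ae_of_all _ fun y hy => hC' _ (hIcc y hy)))
  have hlim : Tendsto (fun n : ℕ => ∫ y in D, (χ ‖y - x‖ * inner ℝ (gradient u y)
        (ramp (scale n) (u y) • gradient u y) +
      rampInt (scale n) (u y) * deriv χ ‖y - x‖ *
        inner ℝ (gradient u y) (‖y - x‖⁻¹ • (y - x)))) atTop
      (𝓝 (∫ y in D, (χ ‖y - x‖ * (posSet D u).indicator (fun y => ‖gradient u y‖ ^ 2) y +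
        deriv χ ‖y - x‖ * (posSet D u).indicator (fun y =>
        u y * inner ℝ (gradient u y) (‖y - x‖⁻¹ • (y - x))) y))) := by
    refine tendsto_integral_filter_of_dominated_convergence
      (fun y => ‖χ ‖y - x‖ * (posSet D u).indicator (fun y => ‖gradient u y‖ ^ 2) y‖ +
        ‖deriv χ ‖y - x‖ * (posSet D u).indicator (fun y =>
        u y * inner ℝ (gradient u y) (‖y - x‖⁻¹ • (y - x))) y‖) ?_ ?_ (i1.norm.add i2.norm) ?_
    · refine Eventually.of_forall fun n => ?_
      have mg : Measurable (gradient u) :=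
        (InnerProductSpace.toDual ℝ Plane).symm.continuous.measurable.comp
          (measurable_fderiv ℝ u)
      have hu := h.continuousOn.aestronglyMeasurable (μ := volume) hDm
      have hsub : Continuous fun y : Plane => y - x := by fun_prop
      have hρ : Measurable fun y : Plane => ‖y - x‖ := hsub.measurable.norm
      refine AEStronglyMeasurable.add
        (AEStronglyMeasurable.mul (hχ.continuous.measurable.comp hρ).aestronglyMeasurable
          (mg.aestronglyMeasurable.inner (AEStronglyMeasurable.smul
            ((continuous_ramp _).comp_aestronglyMeasurable hu) mg.aestronglyMeasurable)))
        (AEStronglyMeasurable.mul (AEStronglyMeasurable.mul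
          ((contDiff_rampInt _).continuous.comp_aestronglyMeasurable hu)
          (hχ'.measurable.comp hρ).aestronglyMeasurable)
          (mg.inner (hρ.inv.smul hsub.measurable)).aestronglyMeasurable)
    · refine Eventually.of_forall fun n =>
        (ae_restrict_iff' hDm).2 (ae_of_all _ fun y hy => ?_)
      rcases lt_or_ge 0 (u y) with hp | hp
      · have hy' : y ∈ posSet D u := ⟨hy, hp⟩
        rw [indicator_of_mem hy', indicator_of_mem hy', inner_smul_right,
          real_inner_self_eq_norm_sq]
        refine (norm_add_le _ _).trans (add_le_add ?_ ?_)
        · simp only [norm_mul]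
          refine mul_le_mul_of_nonneg_left (mul_le_of_le_one_left (norm_nonneg _) ?_)
            (norm_nonneg _)
          rw [Real.norm_of_nonneg (ramp_nonneg _ _)]
          exact ramp_le_one _ _
        · simp only [norm_mul]
          rw [mul_comm ‖rampInt _ _‖, mul_assoc]
          refine mul_le_mul_of_nonneg_left (mul_le_mul_of_nonneg_right ?_ (norm_nonneg _))
            (norm_nonneg _)
          exact abs_rampInt_le (scale_pos n) _
      · rw [ramp_eq_zero (scale_pos n) (hp.trans (scale_pos n).le),
          rampInt_eq_zero (scale_pos n) (hp.trans (scale_pos n).le)]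
        simp only [zero_smul, inner_zero_right, mul_zero, zero_mul, add_zero, norm_zero]
        positivity
    · refine (ae_restrict_iff' hDm).2 (ae_of_all _ fun y hy => ?_)
      refine Tendsto.add (Tendsto.const_mul _ ?_) ?_
      · have := (tendsto_const_nhds (x := gradient u y)).inner (𝕜 := ℝ)
          (tendsto_ramp_smul_gradient (u := u) hy)
        convert this using 2
        by_cases hy' : y ∈ posSet D u
        · rw [indicator_of_mem hy', indicator_of_mem hy', real_inner_self_eq_norm_sq]
        · rw [indicator_of_notMem hy', indicator_of_notMem hy', inner_zero_right]
      · have := ((tendsto_rampInt_scale (u y)).mul_const (deriv χ ‖y - x‖)).mul_const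
          (inner ℝ (gradient u y) (‖y - x‖⁻¹ • (y - x)))
        convert this using 2
        by_cases hy' : y ∈ posSet D u
        · rw [indicator_of_mem hy', max_eq_left (le_of_lt (show 0 < u y from hy'.2))]
          ring
        · rw [indicator_of_notMem hy', max_eq_right (not_lt.1 fun hp => hy' ⟨hy, hp⟩)]
          ring
  have h0 := tendsto_nhds_unique hlim (by simp only [hweak]; exact tendsto_const_nhds)
  rw [integral_add i1 i2, setIntegral_eq_integral_of_forall_compl_eq_zero,
    setIntegral_eq_integral_of_forall_compl_eq_zero] at h0
  · linarith
  · intro y hy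
    rw [indicator_of_notMem (fun h => hy h.1), mul_zero]
  · intro y hy
    rw [indicator_of_notMem (fun h => hy h.1), mul_zero]

end

section

/-! ### Polar coordinates around a point -/

variable (x : Plane) (b : OrthonormalBasis (Fin 2) ℝ Plane)

/-- The unit vector at angle `θ` in the orthonormal frame `b`. -/
def radialVec (θ : ℝ) : Plane := Real.cos θ • b 0 + Real.sin θ • b 1

/-- The unit vector orthogonal to `radialVec b θ`, its derivative in `θ`. -/
def angularVec (θ : ℝ) : Plane := -Real.sin θ • b 0 + Real.cos θ • b 1

/-- The point with polar coordinates `(r, θ)` around `x` in the orthonormal frame `b`. -/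
def polarPt (r θ : ℝ) : Plane := x + r • radialVec b θ

theorem inner_basis_zero_one : inner ℝ (b 0) (b 1) = 0 := b.orthonormal.2 (by decide)

theorem norm_comb_sq (s c : ℝ) : ‖s • b 0 + c • b 1‖ ^ 2 = s ^ 2 + c ^ 2 := by
  rw [norm_add_sq_real, norm_smul, norm_smul, b.norm_eq_one, b.norm_eq_one, inner_smul_left,
    inner_smul_right, inner_basis_zero_one]
  simp

theorem norm_radialVec (θ : ℝ) : ‖radialVec b θ‖ = 1 := by
  have := norm_comb_sq b (Real.cos θ) (Real.sin θ)
  rw [Real.cos_sq_add_sin_sq] at this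
  exact (pow_eq_one_iff_of_nonneg (norm_nonneg _) two_ne_zero).1 this

theorem norm_polarPt_sub {r : ℝ} (hr : 0 ≤ r) (θ : ℝ) : ‖polarPt x b r θ - x‖ = r := by
  rw [polarPt, add_sub_cancel_left, norm_smul, norm_radialVec, Real.norm_of_nonneg hr, mul_one]

theorem continuous_polarPt : Continuous fun p : ℝ × ℝ => polarPt x b p.1 p.2 := by
  unfold polarPt radialVec
  fun_prop

theorem hasDerivAt_polarPt (r θ : ℝ) :
    HasDerivAt (polarPt x b r) (r • angularVec b θ) θ := by
  unfold polarPt radialVec angularVec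
  have h1 := ((Real.hasDerivAt_cos θ).smul_const (b 0)).add
    ((Real.hasDerivAt_sin θ).smul_const (b 1))
  exact (h1.const_smul r).const_add x

/-- Pythagoras in the moving frame. -/
theorem inner_sq_add_inner_sq (v : Plane) (θ : ℝ) :
    inner ℝ v (radialVec b θ) ^ 2 + inner ℝ v (angularVec b θ) ^ 2 = ‖v‖ ^ 2 := by
  have h := b.sum_sq_norm_inner_left v
  rw [Fin.sum_univ_two] at h
  simp only [radialVec, angularVec, inner_add_right, inner_smul_right, ← h, Real.norm_eq_abs,
    sq_abs]
  linear_combination (inner ℝ v (b 0) ^ 2 + inner ℝ v (b 1) ^ 2) * Real.sin_sq_add_cos_sq θ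

/-- Cartesian coordinates in the frame `b` centred at `x`. -/
def cartesian (p : ℝ × ℝ) : Plane := x + (p.1 • b 0 + p.2 • b 1)

theorem measurePreserving_cartesian : MeasurePreserving (cartesian x b) := by
  have h1 := (MeasureTheory.volume_preserving_finTwoArrow ℝ).symm
  have h2 := (EuclideanSpace.volume_preserving_symm_measurableEquiv_toLp (Fin 2)).symm
  have h3 := b.measurePreserving_repr_symm
  have h4 := measurePreserving_add_left (volume : Measure Plane) x
  have := h4.comp (h3.comp (h2.comp h1))
  have e : cartesian x b = (fun z => x + z) ∘ b.repr.symm ∘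
      (MeasurableEquiv.toLp 2 (Fin 2 → ℝ)).symm.symm ∘ MeasurableEquiv.finTwoArrow.symm := by
    funext p
    simp [cartesian, ← b.sum_repr_symm, Fin.sum_univ_two, MeasurableEquiv.finTwoArrow,
      MeasurableEquiv.piFinTwo]
  rw [e]
  exact this

theorem cartesian_polarCoord_symm (p : ℝ × ℝ) :
    cartesian x b (polarCoord.symm p) = polarPt x b p.1 p.2 := by
  simp [cartesian, polarPt, radialVec, smul_smul]

variable {F : Plane → ℝ}

theorem lintegral_polarPt {F : Plane → ENNReal} (hF : Measurable F) :
    ∫⁻ p in Ioi (0 : ℝ) ×ˢ Ioo (-Real.pi) Real.pi,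
      ENNReal.ofReal p.1 * F (polarPt x b p.1 p.2) = ∫⁻ y, F y := by
  rw [← (measurePreserving_cartesian x b).lintegral_comp hF,
    ← lintegral_comp_polarCoord_symm, polarCoord_target]
  simp only [cartesian_polarCoord_symm, smul_eq_mul]

theorem integral_polarPt (hF : Measurable F) :
    ∫ p in Ioi (0 : ℝ) ×ˢ Ioo (-Real.pi) Real.pi, p.1 * F (polarPt x b p.1 p.2) = ∫ y, F y := by
  rw [← (measurePreserving_cartesian x b).map_eq,
    integral_map (measurePreserving_cartesian x b).measurable.aemeasurable
      hF.aestronglyMeasurable,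
    ← integral_comp_polarCoord_symm, polarCoord_target]
  simp only [cartesian_polarCoord_symm, smul_eq_mul]

theorem measurable_comp_polarPt (hF : Measurable F) :
    Measurable fun p : ℝ × ℝ => p.1 * F (polarPt x b p.1 p.2) :=
  measurable_fst.mul (hF.comp (continuous_polarPt x b).measurable)

theorem integrableOn_polarPt (hF : Measurable F) (hi : Integrable F) :
    IntegrableOn (fun p : ℝ × ℝ => p.1 * F (polarPt x b p.1 p.2))
      (Ioi (0 : ℝ) ×ˢ Ioo (-Real.pi) Real.pi) := by
  refine ⟨(measurable_comp_polarPt x b hF).aestronglyMeasurable, ?_⟩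
  have h := hi.2
  rw [hasFiniteIntegral_iff_enorm] at h ⊢
  rw [← lintegral_polarPt x b hF.enorm] at h
  refine lt_of_le_of_lt (le_of_eq ?_) h
  refine setLIntegral_congr_fun (measurableSet_Ioi.prod measurableSet_Ioo) fun p hp => ?_
  have hp1 : 0 < p.1 := hp.1
  simp only [enorm_mul, Real.enorm_eq_ofReal hp1.le]

/-- The integral of `F` over the circle of radius `r` around `x`, with respect to arc length. -/
def circleInt (F : Plane → ℝ) (r : ℝ) : ℝ :=
  ∫ θ in Ioo (-Real.pi) Real.pi, r * F (polarPt x b r θ)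

theorem volume_restrict_polar_target :
    (volume : Measure (ℝ × ℝ)).restrict (Ioi (0 : ℝ) ×ˢ Ioo (-Real.pi) Real.pi) =
      (volume.restrict (Ioi 0)).prod (volume.restrict (Ioo (-Real.pi) Real.pi)) := by
  rw [Measure.prod_restrict]; rfl

theorem integrableOn_circleInt (hF : Measurable F) (hi : Integrable F) :
    IntegrableOn (circleInt x b F) (Ioi 0) := by
  have h := integrableOn_polarPt x b hF hi
  rw [IntegrableOn, volume_restrict_polar_target] at h
  exact h.integral_prod_left

theorem ae_integrableOn_circle (hF : Measurable F) (hi : Integrable F) :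
    ∀ᵐ r ∂volume.restrict (Ioi (0 : ℝ)),
      IntegrableOn (fun θ => r * F (polarPt x b r θ)) (Ioo (-Real.pi) Real.pi) := by
  have h := integrableOn_polarPt x b hF hi
  rw [IntegrableOn, volume_restrict_polar_target] at h
  exact h.prod_right_ae

theorem integral_eq_integral_circleInt (hF : Measurable F) (hi : Integrable F) :
    ∫ y, F y = ∫ r in Ioi (0 : ℝ), circleInt x b F r := by
  have h := integrableOn_polarPt x b hF hi
  rw [IntegrableOn, volume_restrict_polar_target] at h
  rw [← integral_polarPt x b hF, volume_restrict_polar_target, integral_prod _ h]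
  rfl

theorem integral_radial_mul (hF : Measurable F) {χ : ℝ → ℝ} (hχ : Measurable χ)
    (hi : Integrable fun y => χ ‖y - x‖ * F y) :
    ∫ y, χ ‖y - x‖ * F y = ∫ r in Ioi (0 : ℝ), χ r * circleInt x b F r := by
  have hsub : Continuous fun y : Plane => ‖y - x‖ := by fun_prop
  have hm : Measurable fun y => χ ‖y - x‖ * F y := (hχ.comp hsub.measurable).mul hF
  rw [integral_eq_integral_circleInt x b hm hi]
  refine setIntegral_congr_fun measurableSet_Ioi fun r hr => ?_
  simp only [circleInt]
  rw [← integral_const_mul]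
  refine integral_congr_ae (ae_of_all _ fun θ => ?_)
  simp only [norm_polarPt_sub x b (le_of_lt (mem_Ioi.1 hr))]
  ring

theorem integral_ball_eq (hF : Measurable F) (hi : Integrable F) (t : ℝ) :
    ∫ y in Metric.ball x t, F y = ∫ r in Ioo 0 t, circleInt x b F r := by
  have e : ∀ y, (Metric.ball x t).indicator F y =
      (Iio t).indicator (fun _ => (1 : ℝ)) ‖y - x‖ * F y := by
    intro y
    have hiff : y ∈ Metric.ball x t ↔ ‖y - x‖ < t := mem_ball_iff_norm
    simp only [indicator, hiff, mem_Iio]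
    split_ifs <;> simp
  rw [← integral_indicator measurableSet_ball]
  simp_rw [e]
  rw [integral_radial_mul x b hF (measurable_const.indicator measurableSet_Iio)]
  · rw [← Ioi_inter_Iio, ← setIntegral_indicator measurableSet_Iio]
    refine integral_congr_ae (ae_of_all _ fun r => ?_)
    by_cases hr : r ∈ Iio t
    · simp [indicator_of_mem hr]
    · simp [indicator_of_notMem hr]
  · simp_rw [← e]
    exact hi.indicator measurableSet_ball

end

section

/-! ### The energy identity on circles -/

variable {D : Set Plane} {x : Plane} {R : ℝ} {u : Plane → ℝ}
  {b : OrthonormalBasis (Fin 2) ℝ Plane}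

/-- The energy of `u⁺` in `B_t(x)`, written in polar coordinates. -/
def discEnergy (x : Plane) (b : OrthonormalBasis (Fin 2) ℝ Plane) (D : Set Plane)
    (u : Plane → ℝ) (t : ℝ) : ℝ :=
  ∫ r in (0 : ℝ)..t, circleInt x b (density D u) r

theorem density_nonneg (y : Plane) : 0 ≤ density D u y :=
  indicator_nonneg (fun _ _ => sq_nonneg _) y

theorem circleInt_density_nonneg {r : ℝ} (hr : 0 ≤ r) : 0 ≤ circleInt x b (density D u) r :=
  integral_nonneg fun _ => mul_nonneg hr (density_nonneg _)

theorem discEnergy_nonneg {t : ℝ} (ht : 0 ≤ t) : 0 ≤ discEnergy x b D u t :=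
  intervalIntegral.integral_nonneg ht fun _ hr => circleInt_density_nonneg hr.1

theorem intervalIntegrable_circleInt {F : Plane → ℝ} (hF : Measurable F) (hi : Integrable F)
    {s t : ℝ} (hs : 0 ≤ s) (ht : 0 ≤ t) : IntervalIntegrable (circleInt x b F) volume s t := by
  rw [intervalIntegrable_iff]
  refine (integrableOn_circleInt x b hF hi).mono_set fun r hr => ?_
  exact lt_of_le_of_lt (le_min hs ht) hr.1

namespace Admissible

theorem integral_ball_density (h : Admissible D x R u) {t : ℝ} (ht : 0 ≤ t) :
    ∫ y in Metric.ball x t, density D u y = discEnergy x b D u t := by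
  rw [integral_ball_eq x b h.measurable_density h.integrable_density, discEnergy,
    intervalIntegral.integral_of_le ht, integral_Ioc_eq_integral_Ioo]

theorem ae_hasDerivAt_discEnergy (h : Admissible D x R u) :
    ∀ᵐ r : ℝ, r ∈ Icc 0 R →
      HasDerivAt (discEnergy x b D u) (circleInt x b (density D u) r) r := by
  rcases le_total 0 R with hR | hR
  · have hi := intervalIntegrable_circleInt (x := x) (b := b) h.measurable_density
      h.integrable_density le_rfl hR
    filter_upwards [hi.ae_hasDerivAt_integral] with r hr hr'
    exact hr (by rwa [uIcc_of_le hR]) 0 left_mem_uIcc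
  · have : ({0} : Set ℝ)ᶜ ∈ ae volume := by simp [mem_ae_iff]
    filter_upwards [this] with r hr hr'
    exact absurd (le_antisymm (hr'.2.trans hR) hr'.1) hr

theorem absolutelyContinuousOnInterval_discEnergy (h : Admissible D x R u) {t : ℝ} (ht : 0 ≤ t) :
    AbsolutelyContinuousOnInterval (discEnergy x b D u) 0 t :=
  (intervalIntegrable_circleInt h.measurable_density h.integrable_density le_rfl
    ht).absolutelyContinuousOnInterval_intervalIntegral left_mem_uIcc

/-- On almost every circle the energy inside equals the flux of `u⁺ ∂_r u⁺`. -/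
theorem ae_discEnergy_eq_flux (h : Admissible D x R u) (hR : 0 < R) :
    ∀ᵐ r : ℝ, r ∈ Ioo 0 R → discEnergy x b D u r = circleInt x b (flux D x u) r := by
  have ia := intervalIntegrable_circleInt (x := x) (b := b) h.measurable_density
      h.integrable_density le_rfl hR.le
  have ib := intervalIntegrable_circleInt (x := x) (b := b) h.measurable_flux
      h.integrable_flux le_rfl hR.le
  have hac := h.absolutelyContinuousOnInterval_discEnergy (b := b) hR.le
  have hcont : ContinuousOn (discEnergy x b D u) (Icc 0 R) := by
    have := hac.continuousOn
    rwa [uIcc_of_le hR.le] at this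
  have iA : IntegrableOn (discEnergy x b D u) (Ioo 0 R) :=
    (hcont.integrableOn_compact isCompact_Icc).mono_set Ioo_subset_Icc_self
  have ib' : IntegrableOn (circleInt x b (flux D x u)) (Ioo 0 R) := by
    rw [intervalIntegrable_iff_integrableOn_Ioo_of_le hR.le] at ib; exact ib
  have key := isOpen_Ioo.ae_eq_zero_of_integral_contDiff_smul_eq_zero (μ := volume)
    (f := fun r => discEnergy x b D u r - circleInt x b (flux D x u) r)
    (iA.sub ib').locallyIntegrableOn ?_
  · filter_upwards [key] with r hr hr'
    exact sub_eq_zero.1 (hr hr')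
  intro ψ hψ hc hs
  have hψ0 : ∀ r ∉ Ioo 0 R, ψ r = 0 := fun r hr =>
    image_eq_zero_of_notMem_tsupport fun h => hr (hs h)
  -- the support of `ψ` stays away from `R`
  obtain ⟨r', hr', hψr'⟩ : ∃ r' < R, ∀ s, r' < s → ψ s = 0 := by
    rcases (tsupport ψ).eq_empty_or_nonempty with he | hne
    · exact ⟨0, hR, fun s _ => image_eq_zero_of_notMem_tsupport (by simp [he])⟩
    · obtain ⟨m, hm, hmax⟩ := hc.exists_isGreatest hne
      exact ⟨m, (hs hm).2, fun s hs' => image_eq_zero_of_notMem_tsupport fun hmem =>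
        absurd (hmax hmem) (not_le.2 hs')⟩
  -- the radial cut-off with derivative `ψ`; an integration by parts follows
  set χ : ℝ → ℝ := fun s => ∫ t in R..s, ψ t with hχdef
  have hχd : ∀ s, HasDerivAt χ (ψ s) s := fun s =>
    (hψ.continuous.integral_hasStrictDerivAt R s).hasDerivAt
  have hχ' : deriv χ = ψ := funext fun s => (hχd s).deriv
  have hχ : ContDiff ℝ 1 χ := by
    rw [contDiff_one_iff_deriv]
    exact ⟨fun s => (hχd s).differentiableAt, by rw [hχ']; exact hψ.continuous⟩
  have hχ0 : ∀ s, r' ≤ s → χ s = 0 := by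
    intro s hs'
    apply intervalIntegral.integral_zero_ae
    refine ae_of_all _ fun t ht => hψr' t ?_
    exact (le_min hr'.le hs').trans_lt ht.1
  have hid := h.integral_radial_identity hχ hr' hχ0
  rw [hχ'] at hid
  obtain ⟨Cψ, hCψ⟩ := hψ.continuous.bounded_above_of_compact_support hc
  obtain ⟨Cχ, hCχ⟩ := isCompact_Icc.exists_bound_of_continuousOn
    (s := Icc (0 : ℝ) R) hχ.continuous.continuousOn
  have hρ : Continuous fun y : Plane => ‖y - x‖ := by fun_prop
  have hχbd : ∀ y : Plane, ‖χ ‖y - x‖‖ ≤ |Cχ| := by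
    intro y
    rcases le_total ‖y - x‖ R with h1 | h1
    · exact (hCχ _ ⟨norm_nonneg _, h1⟩).trans (le_abs_self _)
    · rw [hχ0 _ (hr'.le.trans h1), norm_zero]; exact abs_nonneg _
  rw [integral_radial_mul x b h.measurable_density hχ.continuous.measurable
      (h.integrable_density.bdd_mul (hχ.continuous.comp hρ).aestronglyMeasurable
        (ae_of_all _ hχbd)),
    integral_radial_mul x b h.measurable_flux hψ.continuous.measurable
      (h.integrable_flux.bdd_mul (hψ.continuous.comp hρ).aestronglyMeasurable
        (ae_of_all _ fun y => hCψ _))] at hid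
  have hcut : ∀ f g : ℝ → ℝ, (∀ s, R ≤ s → f s = 0) →
      ∫ r in Ioi (0 : ℝ), f r * g r = ∫ r in (0 : ℝ)..R, f r * g r := by
    intro f g hf
    rw [intervalIntegral.integral_of_le hR.le]
    refine (setIntegral_eq_of_subset_of_forall_sdiff_eq_zero measurableSet_Ioi
      Ioc_subset_Ioi_self fun r hr => ?_)
    rw [hf r (not_lt.1 fun hlt => hr.2 ⟨hr.1, hlt.le⟩), zero_mul]
  rw [hcut _ _ fun s hs' => hχ0 s (hr'.le.trans hs'),
    hcut _ _ fun s hs' => hψr' s (hr'.trans_le hs')] at hid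
  have hparts := AbsolutelyContinuousOnInterval.integral_mul_deriv_eq_deriv_mul
    (hχ.contDiffOn (s := uIcc 0 R)).absolutelyContinuousOnInterval hac
  have hderiv : ∫ r in (0 : ℝ)..R, χ r * deriv (discEnergy x b D u) r =
      ∫ r in (0 : ℝ)..R, χ r * circleInt x b (density D u) r := by
    refine intervalIntegral.integral_congr_ae ?_
    filter_upwards [h.ae_hasDerivAt_discEnergy (b := b)] with r hr hr'
    rw [uIoc_of_le hR.le] at hr'
    rw [(hr (Ioc_subset_Icc_self hr')).deriv]
  have hA0 : discEnergy x b D u 0 = 0 := by simp [discEnergy]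
  rw [hderiv, hid, hχ0 R hr'.le, hA0, hχ', zero_mul, mul_zero, sub_zero, zero_sub,
    neg_inj] at hparts
  have i1 : IntervalIntegrable (fun r => ψ r * discEnergy x b D u r) volume 0 R :=
    (hψ.continuous.continuousOn.mul (by rwa [uIcc_of_le hR.le])).intervalIntegrable
  have i2 : IntervalIntegrable (fun r => ψ r * circleInt x b (flux D x u) r) volume 0 R :=
    ib.continuousOn_mul hψ.continuous.continuousOn
  rw [← setIntegral_eq_integral_of_forall_compl_eq_zero (s := Ioo 0 R)
    (fun r hr => by rw [hψ0 r hr, zero_smul]), ← integral_Ioc_eq_integral_Ioo,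
    ← intervalIntegral.integral_of_le hR.le]
  simp only [smul_eq_mul, mul_sub]
  rw [intervalIntegral.integral_sub i1 i2, hparts, sub_self]

/-! ### The inequality on a single arc -/

/-- The arc form of the Wirtinger inequality combined with Young's inequality: on an arc on which
`u` has a non-positive value, the flux of `u⁺ ∂_r u⁺` is at most `ℓ r / π` times the energy on the
arc, where `ℓ` is an upper bound for the angular measure of `{u > 0}`. -/
theorem circleInt_flux_le (h : Admissible D x R u) {r : ℝ} (hr : 0 < r) {α β θ₀ : ℝ}
    (hT : Ioo (-Real.pi) Real.pi ∩ {θ | polarPt x b r θ ∈ D} = Ioo α β)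
    (hθ₀ : θ₀ ∈ Ioo α β) (hu₀ : u (polarPt x b r θ₀) ≤ 0) {ℓ : ℝ} (hℓ0 : 0 < ℓ)
    (hℓ : volume (Ioo α β ∩ {θ | 0 < u (polarPt x b r θ)}) ≤ ENNReal.ofReal ℓ)
    (hdens : IntegrableOn (fun θ => r * density D u (polarPt x b r θ))
      (Ioo (-Real.pi) Real.pi))
    (hsq : IntegrableOn (fun θ => r * posSq D u (polarPt x b r θ)) (Ioo (-Real.pi) Real.pi))
    (hflux : IntegrableOn (fun θ => r * flux D x u (polarPt x b r θ))
      (Ioo (-Real.pi) Real.pi)) :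
    circleInt x b (flux D x u) r ≤ ℓ * r / Real.pi * circleInt x b (density D u) r := by
  have hpi := Real.pi_pos
  set E : ℝ → Plane := polarPt x b r with hE
  have hEd : ∀ θ, HasDerivAt E (r • angularVec b θ) θ := hasDerivAt_polarPt x b r
  have hEc : Continuous E := continuous_iff_continuousAt.2 fun θ => (hEd θ).continuousAt
  set w : ℝ → ℝ := fun θ => u (E θ) with hw
  set w' : ℝ → ℝ := fun θ => r * inner ℝ (gradient u (E θ)) (angularVec b θ) with hw'
  set ur : ℝ → ℝ := fun θ => inner ℝ (gradient u (E θ)) (radialVec b θ) with hur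
  set O := Ioo α β ∩ {θ | 0 < w θ} with hO
  have hmem : ∀ θ ∈ Ioo α β, E θ ∈ D := fun θ hθ => by rw [← hT] at hθ; exact hθ.2
  have hOpos : ∀ θ ∈ O, E θ ∈ posSet D u := fun θ hθ => ⟨hmem θ hθ.1, hθ.2⟩
  have hwc : ContinuousOn w (Ioo α β) := h.continuousOn.comp hEc.continuousOn hmem
  have hOo : IsOpen O := hwc.isOpen_inter_preimage isOpen_Ioo (isOpen_Ioi (a := (0 : ℝ)))
  have hOm := hOo.measurableSet
  have hOsub : O ⊆ Ioo (-Real.pi) Real.pi := fun θ hθ => by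
    have := hθ.1; rw [← hT] at this; exact this.1
  have hOiff : ∀ θ ∈ Ioo (-Real.pi) Real.pi, E θ ∈ posSet D u → θ ∈ O := fun θ hθ hp => by
    refine ⟨?_, hp.2⟩
    rw [← hT]; exact ⟨hθ, hp.1⟩
  have hgc : ContinuousOn (fun θ => gradient u (E θ)) O :=
    h.continuousOn_gradient_posSet.comp hEc.continuousOn hOpos
  have hradc : Continuous (radialVec b) := by unfold radialVec; fun_prop
  have hangc : Continuous (angularVec b) := by unfold angularVec; fun_prop
  have hurc : ContinuousOn ur O := hgc.inner hradc.continuousOn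
  have hw'c : ContinuousOn w' O := continuousOn_const.mul (hgc.inner hangc.continuousOn)
  have hwd : ∀ θ ∈ Ioo α β, 0 < w θ → HasDerivAt w (w' θ) θ := by
    intro θ hθ hp
    have d1 : HasFDerivAt u (fderiv ℝ u (E θ)) (E θ) :=
      ((h.contDiffAt _ (hmem θ hθ) hp.ne').differentiableAt (by simp)).hasFDerivAt
    have d2 := d1.comp_hasDerivAt θ (hEd θ)
    rwa [map_smul, smul_eq_mul, ← inner_gradient_left] at d2
  -- the circle integrals are integrals over `O`
  have hind : ∀ (F : Plane → ℝ) (G : ℝ → ℝ), (∀ θ ∈ O, (posSet D u).indicator F (E θ) = G θ) →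
      (∀ θ ∈ Ioo (-Real.pi) Real.pi, r * (posSet D u).indicator F (E θ) =
        O.indicator (fun θ => r * G θ) θ) := by
    intro F G hFG θ hθ
    by_cases hm : θ ∈ O
    · rw [indicator_of_mem hm, hFG θ hm]
    · rw [indicator_of_notMem hm, indicator_of_notMem (fun hp => hm (hOiff θ hθ hp)), mul_zero]
  have hindint : ∀ (F : Plane → ℝ) (G : ℝ → ℝ),
      (∀ θ ∈ O, (posSet D u).indicator F (E θ) = G θ) →
      (IntegrableOn (fun θ => r * (posSet D u).indicator F (E θ)) (Ioo (-Real.pi) Real.pi) →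
        IntegrableOn G O) ∧
      circleInt x b ((posSet D u).indicator F) r = r * ∫ θ in O, G θ := by
    intro F G hFG
    have h1 := hind F G hFG
    constructor
    · intro hi
      have h2 : IntegrableOn (fun θ => r⁻¹ * (r * (posSet D u).indicator F (E θ))) O :=
        (hi.mono_set hOsub).const_mul _
      refine h2.congr_fun (fun θ hθ => ?_) hOm
      simp only [hFG θ hθ]
      field_simp
    · rw [circleInt, setIntegral_congr_fun measurableSet_Ioo h1, setIntegral_indicator hOm,
        inter_eq_self_of_subset_right hOsub, integral_const_mul]
  have hdensO := hindint (fun y => ‖gradient u y‖ ^ 2) (fun θ => ‖gradient u (E θ)‖ ^ 2)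
    fun θ hθ => indicator_of_mem (hOpos θ hθ) _
  have hsqO := hindint (fun y => u y ^ 2) (fun θ => w θ ^ 2)
    fun θ hθ => indicator_of_mem (hOpos θ hθ) _
  have hfluxO := hindint (fun y => u y * inner ℝ (gradient u y) (‖y - x‖⁻¹ • (y - x)))
    (fun θ => w θ * ur θ) fun θ hθ => by
      rw [indicator_of_mem (hOpos θ hθ)]
      have e : ‖E θ - x‖⁻¹ • (E θ - x) = radialVec b θ := by
        rw [hE, norm_polarPt_sub x b hr.le, polarPt, add_sub_cancel_left, smul_smul,
          inv_mul_cancel₀ hr.ne', one_smul]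
      rw [e]
  have iD : IntegrableOn (fun θ => ‖gradient u (E θ)‖ ^ 2) O := hdensO.1 hdens
  have iS : IntegrableOn (fun θ => w θ ^ 2) O := hsqO.1 hsq
  have iF : IntegrableOn (fun θ => w θ * ur θ) O := hfluxO.1 hflux
  have hpyth : ∀ θ, ur θ ^ 2 + (w' θ / r) ^ 2 = ‖gradient u (E θ)‖ ^ 2 := fun θ => by
    rw [← inner_sq_add_inner_sq b _ θ, hw', mul_div_cancel_left₀ _ hr.ne']
  have iU : IntegrableOn (fun θ => ur θ ^ 2) O := by
    refine Integrable.mono' iD ((hurc.pow 2).aestronglyMeasurable hOm) (ae_of_all _ fun θ => ?_)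
    rw [Real.norm_of_nonneg (sq_nonneg _), ← hpyth θ]
    exact le_add_of_nonneg_right (sq_nonneg _)
  have iW : IntegrableOn (fun θ => (w' θ / r) ^ 2) O := by
    refine Integrable.mono' iD (((hw'c.div_const r).pow 2).aestronglyMeasurable hOm)
      (ae_of_all _ fun θ => ?_)
    rw [Real.norm_of_nonneg (sq_nonneg _), ← hpyth θ]
    exact le_add_of_nonneg_left (sq_nonneg _)
  have iW' : IntegrableOn (fun θ => w' θ ^ 2) O := by
    have : IntegrableOn (fun θ => r ^ 2 * (w' θ / r) ^ 2) O := iW.const_mul _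
    refine this.congr_fun (fun θ _ => ?_) hOm
    simp only
    field_simp
  have hW' : ∫ θ in O, w' θ ^ 2 = r ^ 2 * ∫ θ in O, (w' θ / r) ^ 2 := by
    rw [← integral_const_mul]
    refine integral_congr_ae (ae_of_all _ fun θ => ?_)
    simp only
    field_simp
  have hwirt := lintegral_sq_le_of_nonpos hwc hwd hw'c hθ₀ hu₀ hℓ0 hℓ
  rw [← ofReal_integral_eq_lintegral_ofReal iS (ae_of_all _ fun θ => sq_nonneg _),
    ← ofReal_integral_eq_lintegral_ofReal iW' (ae_of_all _ fun θ => sq_nonneg _),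
    ← ENNReal.ofReal_mul (sq_nonneg _), ENNReal.ofReal_le_ofReal_iff
      (mul_nonneg (sq_nonneg _) (integral_nonneg fun θ => sq_nonneg _)), hW'] at hwirt
  -- the weight in Young's inequality that balances the two terms after Wirtinger's inequality
  set c := 2 * ℓ * r / Real.pi with hc
  have hc0 : 0 < c := by positivity
  have hyoung : ∫ θ in O, w θ * ur θ ≤
      ∫ θ in O, (c / 2 * ur θ ^ 2 + 1 / (2 * c) * w θ ^ 2) := by
    refine integral_mono iF ((iU.const_mul _).add (iS.const_mul _)) fun θ => ?_
    have : c / 2 * ur θ ^ 2 + 1 / (2 * c) * w θ ^ 2 - w θ * ur θ =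
        (c * ur θ - w θ) ^ 2 / (2 * c) := by field_simp; ring
    have h2 : 0 ≤ (c * ur θ - w θ) ^ 2 / (2 * c) := by positivity
    simp only
    linarith
  rw [integral_add (iU.const_mul _) (iS.const_mul _), integral_const_mul,
    integral_const_mul] at hyoung
  have hsum : ∫ θ in O, ‖gradient u (E θ)‖ ^ 2 =
      (∫ θ in O, ur θ ^ 2) + ∫ θ in O, (w' θ / r) ^ 2 := by
    rw [← integral_add iU iW]
    exact integral_congr_ae (ae_of_all _ fun θ => (hpyth θ).symm)
  have e1 : circleInt x b (density D u) r = r * ∫ θ in O, ‖gradient u (E θ)‖ ^ 2 := hdensO.2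
  have e2 : circleInt x b (flux D x u) r = r * ∫ θ in O, w θ * ur θ := hfluxO.2
  rw [e1, e2, hsum]
  have h5 : 1 / (2 * c) * ∫ θ in O, w θ ^ 2 ≤ c / 2 * ∫ θ in O, (w' θ / r) ^ 2 := by
    have := mul_le_mul_of_nonneg_left hwirt (show 0 ≤ 1 / (2 * c) by positivity)
    refine this.trans (le_of_eq ?_)
    rw [hc]; field_simp
  have h6 : ∫ θ in O, w θ * ur θ ≤
      c / 2 * ((∫ θ in O, ur θ ^ 2) + ∫ θ in O, (w' θ / r) ^ 2) := by linarith
  have h7 := mul_le_mul_of_nonneg_left h6 hr.le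
  refine h7.trans (le_of_eq ?_)
  rw [hc]; field_simp

end Admissible

end

section

/-! ### Arcs in a half-plane -/

variable {D : Set Plane} {x : Plane} {R : ℝ} {u : Plane → ℝ}
  {b : OrthonormalBasis (Fin 2) ℝ Plane}

theorem inner_polarPt_sub_zero (r θ : ℝ) :
    inner ℝ (polarPt x b r θ - x) (b 0) = r * Real.cos θ := by
  have h : inner ℝ (b 1) (b 0) = 0 := b.orthonormal.2 (by decide)
  simp [polarPt, radialVec, inner_add_left, inner_smul_left, h]

theorem inner_polarPt_sub_one (r θ : ℝ) :
    inner ℝ (polarPt x b r θ - x) (b 1) = r * Real.sin θ := by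
  have h : inner ℝ (b 0) (b 1) = 0 := b.orthonormal.2 (by decide)
  simp [polarPt, radialVec, inner_add_left, inner_smul_left, h]

/-- The polar angle of a point in the half-plane `⟪y - x, b 0⟫ > 0`. -/
def polarAngle (x : Plane) (b : OrthonormalBasis (Fin 2) ℝ Plane) (y : Plane) : ℝ :=
  Real.arcsin (inner ℝ (y - x) (b 1) / ‖y - x‖)

theorem polarPt_polarAngle {y : Plane} (hy : 0 < inner ℝ (y - x) (b 0)) :
    polarPt x b ‖y - x‖ (polarAngle x b y) = y := by
  set c₀ := inner ℝ (y - x) (b 0)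
  set c₁ := inner ℝ (y - x) (b 1) with hc₁
  have hne : y - x ≠ 0 := by
    intro h0
    have : c₀ = 0 := by simp [c₀, h0]
    exact hy.ne' this
  have hr : 0 < ‖y - x‖ := norm_pos_iff.2 hne
  have hsum : c₀ ^ 2 + c₁ ^ 2 = ‖y - x‖ ^ 2 := by
    have h := b.sum_sq_norm_inner_left (y - x)
    rw [Fin.sum_univ_two] at h
    simpa only [Real.norm_eq_abs, sq_abs] using h
  have hle : |c₁ / ‖y - x‖| ≤ 1 := by
    rw [abs_div, abs_norm, div_le_one hr]
    exact abs_le_of_sq_le_sq (by nlinarith [sq_nonneg c₀]) hr.le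
  have hs : Real.sin (polarAngle x b y) = c₁ / ‖y - x‖ :=
    Real.sin_arcsin (abs_le.1 hle).1 (abs_le.1 hle).2
  have hcos : Real.cos (polarAngle x b y) = c₀ / ‖y - x‖ := by
    rw [polarAngle, Real.cos_arcsin, ← hc₁]
    have : 1 - (c₁ / ‖y - x‖) ^ 2 = (c₀ / ‖y - x‖) ^ 2 := by
      field_simp
      linarith
    rw [this, Real.sqrt_sq (by positivity)]
  have hexp : y - x = c₀ • b 0 + c₁ • b 1 := by
    have h := b.sum_repr' (y - x)
    rw [Fin.sum_univ_two, real_inner_comm, real_inner_comm (y - x) (b 1)] at h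
    exact h.symm
  rw [polarPt, radialVec, hs, hcos, smul_add, smul_smul, smul_smul, mul_div_cancel₀ _ hr.ne',
    mul_div_cancel₀ _ hr.ne', ← hexp, add_sub_cancel]

theorem polarAngle_polarPt {r θ : ℝ} (hr : 0 < r) (hθ : θ ∈ Ioo (-(Real.pi / 2)) (Real.pi / 2)) :
    polarAngle x b (polarPt x b r θ) = θ := by
  rw [polarAngle, inner_polarPt_sub_one, norm_polarPt_sub x b hr.le, mul_div_cancel_left₀ _ hr.ne',
    Real.arcsin_sin hθ.1.le hθ.2.le]

theorem polarAngle_mem {y : Plane} (hy : 0 < inner ℝ (y - x) (b 0)) :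
    polarAngle x b y ∈ Ioo (-(Real.pi / 2)) (Real.pi / 2) := by
  have h1 := polarPt_polarAngle hy
  have hne : y - x ≠ 0 := by
    intro h0
    rw [h0, inner_zero_left] at hy
    exact lt_irrefl _ hy
  have hr : 0 < ‖y - x‖ := norm_pos_iff.2 hne
  have hc : 0 < Real.cos (polarAngle x b y) := by
    have h2 := inner_polarPt_sub_zero (x := x) (b := b) ‖y - x‖ (polarAngle x b y)
    rw [h1] at h2
    rw [h2] at hy
    exact (mul_pos_iff_of_pos_left hr).1 hy
  have hm := Real.arcsin_mem_Icc (inner ℝ (y - x) (b 1) / ‖y - x‖)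
  refine ⟨lt_of_le_of_ne hm.1 fun h => ?_, lt_of_le_of_ne hm.2 fun h => ?_⟩
  · rw [← h, Real.cos_neg, Real.cos_pi_div_two] at hc; exact lt_irrefl _ hc
  · rw [h, Real.cos_pi_div_two] at hc; exact lt_irrefl _ hc

theorem mem_Ioo_of_polarPt_mem (hD : ∀ y ∈ D, 0 < inner ℝ (y - x) (b 0)) {r θ : ℝ} (hr : 0 < r)
    (hθ : θ ∈ Ioo (-Real.pi) Real.pi) (hm : polarPt x b r θ ∈ D) :
    θ ∈ Ioo (-(Real.pi / 2)) (Real.pi / 2) := by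
  have h1 := hD _ hm
  rw [inner_polarPt_sub_zero] at h1
  have hc : 0 < Real.cos θ := (mul_pos_iff_of_pos_left hr).1 h1
  by_contra hcon
  rw [mem_Ioo, not_and_or, not_lt, not_lt] at hcon
  rcases hcon with h2 | h2
  · have := Real.cos_nonpos_of_pi_div_two_le_of_le (x := -θ) (by linarith)
      (by linarith [hθ.1, Real.pi_pos])
    rw [Real.cos_neg] at this
    linarith
  · have := Real.cos_nonpos_of_pi_div_two_le_of_le h2 (by linarith [hθ.2, Real.pi_pos])
    linarith

theorem eq_Ioo_of_isOpen_of_isConnected {T : Set ℝ} (ho : IsOpen T)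
    (hc : IsConnected T) (hb : BddBelow T) (ha : BddAbove T) :
    T = Ioo (sInf T) (sSup T) := by
  refine Subset.antisymm (fun θ hθ => ?_) (hc.Ioo_csInf_csSup_subset hb ha)
  obtain ⟨ε, hε, hball⟩ := Metric.isOpen_iff.1 ho θ hθ
  rw [Real.ball_eq_Ioo] at hball
  have h1 : θ - ε / 2 ∈ T := hball ⟨by linarith, by linarith⟩
  have h2 : θ + ε / 2 ∈ T := hball ⟨by linarith, by linarith⟩
  exact ⟨(csInf_le hb h1).trans_lt (by linarith), lt_of_lt_of_le (by linarith) (le_csSup ha h2)⟩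

/-- In the polar angle, a connected circular section of a set in a half-plane is an open interval
of length at most `π`. -/
theorem exists_arc (hDo : IsOpen D) (hD : ∀ y ∈ D, 0 < inner ℝ (y - x) (b 0)) {r : ℝ}
    (hr : 0 < r) (hconn : IsConnected (Metric.sphere x r ∩ D)) :
    ∃ α β, α ≤ β ∧ β - α ≤ Real.pi ∧
      Ioo (-Real.pi) Real.pi ∩ {θ | polarPt x b r θ ∈ D} = Ioo α β := by
  set T := Ioo (-Real.pi) Real.pi ∩ {θ | polarPt x b r θ ∈ D} with hT
  have hpi := Real.pi_pos
  have hsub : T ⊆ Ioo (-(Real.pi / 2)) (Real.pi / 2) := fun θ hθ =>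
    mem_Ioo_of_polarPt_mem hD hr hθ.1 hθ.2
  have hc : Continuous fun θ => polarPt x b r θ :=
    (continuous_polarPt x b).comp (continuous_const.prodMk continuous_id)
  have hTo : IsOpen T := isOpen_Ioo.inter (hDo.preimage hc)
  have himg : T = polarAngle x b '' (Metric.sphere x r ∩ D) := by
    ext θ
    constructor
    · intro hθ
      refine ⟨polarPt x b r θ, ⟨?_, hθ.2⟩, polarAngle_polarPt hr (hsub hθ)⟩
      rw [mem_sphere_iff_norm, norm_polarPt_sub x b hr.le]
    · rintro ⟨y, ⟨hy1, hy2⟩, rfl⟩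
      have hm := polarAngle_mem (hD y hy2)
      refine ⟨⟨by linarith [hm.1], by linarith [hm.2]⟩, ?_⟩
      have h1 := polarPt_polarAngle (hD y hy2)
      rw [mem_sphere_iff_norm.1 hy1] at h1
      rw [mem_ofPred_eq, h1]
      exact hy2
  have hTc : IsConnected T := by
    rw [himg]
    refine hconn.image _ ?_
    have hd : Continuous fun y : Plane => y - x := by fun_prop
    refine Real.continuous_arcsin.comp_continuousOn
      ((hd.inner continuous_const).continuousOn.div hd.norm.continuousOn fun y hy => ?_)
    rw [mem_sphere_iff_norm.1 hy.1]
    exact hr.ne'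
  have hb : BddBelow T := ⟨-(Real.pi / 2), fun θ hθ => (hsub hθ).1.le⟩
  have ha : BddAbove T := ⟨Real.pi / 2, fun θ hθ => (hsub hθ).2.le⟩
  refine ⟨sInf T, sSup T, csInf_le_csSup hTc.nonempty hb ha, ?_,
    eq_Ioo_of_isOpen_of_isConnected hTo hTc hb ha⟩
  have h1 : -(Real.pi / 2) ≤ sInf T := le_csInf hTc.nonempty fun θ hθ => (hsub hθ).1.le
  have h2 : sSup T ≤ Real.pi / 2 := csSup_le hTc.nonempty fun θ hθ => (hsub hθ).2.le
  linarith

/-! ### The differential inequality -/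

namespace Admissible

theorem circleInt_flux_eq_zero {r : ℝ}
    (h0 : ∀ θ ∈ Ioo (-Real.pi) Real.pi, polarPt x b r θ ∉ posSet D u) :
    circleInt x b (flux D x u) r = 0 := by
  rw [circleInt, setIntegral_congr_fun measurableSet_Ioo (g := fun _ => (0 : ℝ))]
  · simp
  · intro θ hθ
    simp only [flux]
    rw [indicator_of_notMem (h0 θ hθ), mul_zero]

theorem isOpen_arc_pos (h : Admissible D x R u) {r α β : ℝ}
    (hT : Ioo (-Real.pi) Real.pi ∩ {θ | polarPt x b r θ ∈ D} = Ioo α β) :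
    IsOpen (Ioo α β ∩ {θ | 0 < u (polarPt x b r θ)}) := by
  have hc : Continuous fun θ => polarPt x b r θ :=
    (continuous_polarPt x b).comp (continuous_const.prodMk continuous_id)
  have hmem : ∀ θ ∈ Ioo α β, polarPt x b r θ ∈ D := fun θ hθ => by rw [← hT] at hθ; exact hθ.2
  exact (h.continuousOn.comp hc.continuousOn hmem).isOpen_inter_preimage isOpen_Ioo
    (isOpen_Ioi (a := (0 : ℝ)))

/-- On almost every circle with a single arc, the logarithmic derivative of the product of the two
energies is at least `4 / r`. If both energies are positive, `u` takes both signs on the arc, and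
the angular measures `ℓ₁`, `ℓ₂` of `{u > 0}` and `{u < 0}` satisfy `ℓ₁ + ℓ₂ ≤ π`, whence
`π / ℓ₁ + π / ℓ₂ ≥ 4`. -/
theorem ae_four_mul_le (h : Admissible D x R u) (hR : 0 < R)
    (hD : ∀ y ∈ D, 0 < inner ℝ (y - x) (b 0)) :
    ∀ᵐ r : ℝ, r ∈ Ioo 0 R → IsConnected (Metric.sphere x r ∩ D) →
      4 * (discEnergy x b D u r * discEnergy x b D (fun y => -u y) r) ≤
        r * (circleInt x b (density D u) r * discEnergy x b D (fun y => -u y) r +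
          discEnergy x b D u r * circleInt x b (density D fun y => -u y) r) := by
  have hn := h.neg
  have hconv : ∀ {F : Plane → ℝ}, Measurable F → Integrable F → ∀ᵐ r : ℝ, r ∈ Ioi (0 : ℝ) →
      IntegrableOn (fun θ => r * F (polarPt x b r θ)) (Ioo (-Real.pi) Real.pi) := fun hm hi =>
    (ae_restrict_iff' measurableSet_Ioi).1 (ae_integrableOn_circle x b hm hi)
  filter_upwards [h.ae_discEnergy_eq_flux (b := b) hR, hn.ae_discEnergy_eq_flux (b := b) hR,
    hconv h.measurable_density h.integrable_density, hconv h.measurable_posSq h.integrable_posSq,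
    hconv h.measurable_flux h.integrable_flux, hconv hn.measurable_density hn.integrable_density,
    hconv hn.measurable_posSq hn.integrable_posSq, hconv hn.measurable_flux hn.integrable_flux]
    with r hA hB i1 i2 i3 i4 i5 i6 hr hconn
  have hr0 : 0 < r := hr.1
  have hpi := Real.pi_pos
  replace hA := hA hr
  replace hB := hB hr
  have hA0 : 0 ≤ discEnergy x b D u r := discEnergy_nonneg hr0.le
  have hB0 : 0 ≤ discEnergy x b D (fun y => -u y) r := discEnergy_nonneg hr0.le
  have ha0 : 0 ≤ circleInt x b (density D u) r := circleInt_density_nonneg hr0.le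
  have hb0 : 0 ≤ circleInt x b (density D fun y => -u y) r := circleInt_density_nonneg hr0.le
  rcases hA0.eq_or_lt with hA1 | hA1
  · rw [← hA1]; simp; positivity
  rcases hB0.eq_or_lt with hB1 | hB1
  · rw [← hB1]; simp; positivity
  obtain ⟨α, β, hαβ, hlen, hT⟩ := exists_arc h.isOpen hD hr0 hconn
  -- both signs occur on the arc
  have hex : ∀ v : Plane → ℝ, 0 < circleInt x b (flux D x v) r →
      ∃ θ ∈ Ioo α β, 0 < v (polarPt x b r θ) := by
    intro v hv
    by_contra! hcon
    refine hv.ne' (circleInt_flux_eq_zero fun θ hθ hp => ?_)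
    exact absurd hp.2 (not_lt.2 (hcon θ (by rw [← hT]; exact ⟨hθ, hp.1⟩)))
  obtain ⟨θ₁, hθ₁, hu₁⟩ := hex u (hA ▸ hA1)
  obtain ⟨θ₂, hθ₂, hu₂⟩ := hex (fun y => -u y) (hB ▸ hB1)
  set O₁ := Ioo α β ∩ {θ | 0 < u (polarPt x b r θ)} with hO₁
  set O₂ := Ioo α β ∩ {θ | 0 < -u (polarPt x b r θ)} with hO₂
  have ho₁ : IsOpen O₁ := h.isOpen_arc_pos hT
  have ho₂ : IsOpen O₂ := hn.isOpen_arc_pos hT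
  have hfin₁ : volume O₁ ≠ ⊤ :=
    ((measure_mono inter_subset_left).trans_lt measure_Ioo_lt_top).ne
  have hfin₂ : volume O₂ ≠ ⊤ :=
    ((measure_mono inter_subset_left).trans_lt measure_Ioo_lt_top).ne
  set ℓ₁ := (volume O₁).toReal with hℓ₁
  set ℓ₂ := (volume O₂).toReal with hℓ₂
  have hpos₁ : 0 < ℓ₁ :=
    ENNReal.toReal_pos (ho₁.measure_pos volume ⟨θ₁, hθ₁, hu₁⟩).ne' hfin₁
  have hpos₂ : 0 < ℓ₂ :=
    ENNReal.toReal_pos (ho₂.measure_pos volume ⟨θ₂, hθ₂, hu₂⟩).ne' hfin₂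
  have hsum : ℓ₁ + ℓ₂ ≤ Real.pi := by
    have hdisj : Disjoint O₁ O₂ := by
      rw [Set.disjoint_left]
      intro θ h1 h2
      have e1 : 0 < u (polarPt x b r θ) := h1.2
      have e2 : 0 < -u (polarPt x b r θ) := h2.2
      linarith
    rw [hℓ₁, hℓ₂, ← ENNReal.toReal_add hfin₁ hfin₂, ← measure_union hdisj ho₂.measurableSet]
    have hle : volume (O₁ ∪ O₂) ≤ ENNReal.ofReal (β - α) := by
      rw [← Real.volume_Ioo]
      exact measure_mono (union_subset inter_subset_left inter_subset_left)
    refine (ENNReal.toReal_mono ENNReal.ofReal_ne_top hle).trans ?_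
    rw [ENNReal.toReal_ofReal (by linarith)]
    exact hlen
  have k₁ := h.circleInt_flux_le hr0 hT hθ₂ (le_of_lt (neg_pos.1 hu₂)) hpos₁
    (ENNReal.ofReal_toReal hfin₁).ge (i1 hr0) (i2 hr0) (i3 hr0)
  have k₂ := hn.circleInt_flux_le hr0 hT hθ₁ (neg_nonpos.2 hu₁.le) hpos₂
    (ENNReal.ofReal_toReal hfin₂).ge (i4 hr0) (i5 hr0) (i6 hr0)
  rw [← hA] at k₁
  rw [← hB] at k₂
  set A := discEnergy x b D u r
  set B := discEnergy x b D (fun y => -u y) r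
  set a := circleInt x b (density D u) r
  set a' := circleInt x b (density D fun y => -u y) r
  have k₁' : Real.pi / ℓ₁ * A ≤ r * a := by
    rw [div_mul_eq_mul_div, div_le_iff₀ hpos₁]
    rw [div_mul_eq_mul_div, le_div_iff₀ hpi] at k₁
    linarith
  have k₂' : Real.pi / ℓ₂ * B ≤ r * a' := by
    rw [div_mul_eq_mul_div, div_le_iff₀ hpos₂]
    rw [div_mul_eq_mul_div, le_div_iff₀ hpi] at k₂
    linarith
  have hfour : 4 ≤ Real.pi / ℓ₁ + Real.pi / ℓ₂ := by
    rw [div_add_div _ _ hpos₁.ne' hpos₂.ne', le_div_iff₀ (by positivity)]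
    nlinarith [sq_nonneg (ℓ₁ - ℓ₂), mul_le_mul_of_nonneg_right hsum (add_pos hpos₁ hpos₂).le]
  have e1 := mul_le_mul_of_nonneg_right k₁' hB0
  have e2 := mul_le_mul_of_nonneg_right k₂' hA0
  have e3 := mul_le_mul_of_nonneg_right hfour (mul_nonneg hA0 hB0)
  nlinarith

/-! ### Monotonicity -/

theorem ae_exists_hasDerivAt_nonneg (h : Admissible D x R u) (hR : 0 < R)
    (hD : ∀ y ∈ D, 0 < inner ℝ (y - x) (b 0)) :
    ∀ᵐ r : ℝ, r ∈ Ioo 0 R → IsConnected (Metric.sphere x r ∩ D) →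
      ∃ d, 0 ≤ d ∧ HasDerivAt (fun t => 1 / t ^ 4 *
        (discEnergy x b D u t * discEnergy x b D (fun y => -u y) t)) d r := by
  filter_upwards [h.ae_four_mul_le hR hD, h.ae_hasDerivAt_discEnergy (b := b),
    h.neg.ae_hasDerivAt_discEnergy (b := b)] with r h1 h2 h3 hr hconn
  have hr0 : r ≠ 0 := hr.1.ne'
  have d1 := ((hasDerivAt_pow 4 r).fun_inv (pow_ne_zero 4 hr0)).mul
    ((h2 (Ioo_subset_Icc_self hr)).mul (h3 (Ioo_subset_Icc_self hr)))
  simp only [one_div]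
  refine ⟨_, ?_, d1⟩
  have h4 := h1 hr hconn
  simp only [Pi.mul_apply]
  set A := discEnergy x b D u r
  set B := discEnergy x b D (fun y => -u y) r
  set a := circleInt x b (density D u) r
  set a' := circleInt x b (density D fun y => -u y) r
  have hr1 : 0 < r := hr.1
  have : -(((4 : ℕ) : ℝ) * r ^ (4 - 1)) / (r ^ 4) ^ 2 * (A * B) + (r ^ 4)⁻¹ * (a * B + A * a') =
      (r * (a * B + A * a') - 4 * (A * B)) / r ^ 5 := by
    norm_num
    field_simp
    ring
  rw [this]
  exact div_nonneg (by linarith) (by positivity)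

theorem monotoneOn_energy_product (h : Admissible D x R u) (hR : 0 < R)
    (hD : ∀ y ∈ D, 0 < inner ℝ (y - x) (b 0)) {s₁ s₂ : ℝ} (hs₁ : 0 ≤ s₁) (hs₂ : s₂ ≤ R)
    (hconn : ∀ r ∈ Ioo s₁ s₂, IsConnected (Metric.sphere x r ∩ D)) :
    MonotoneOn (fun t => 1 / t ^ 4 *
        (discEnergy x b D u t * discEnergy x b D (fun y => -u y) t)) (Ioc s₁ s₂) := by
  intro s hs t ht hst
  have hs0 : 0 < s := hs₁.trans_lt hs.1
  have ht0 : 0 < t := hs0.trans_le hst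
  have hsub : uIcc s t ⊆ uIcc 0 t := by
    rw [uIcc_of_le hst, uIcc_of_le ht0.le]
    exact Icc_subset_Icc_left hs0.le
  have c1 : ContDiffOn ℝ 1 (fun t : ℝ => 1 / t ^ 4) (uIcc s t) := by
    refine contDiffOn_const.div (contDiff_id.pow 4).contDiffOn fun r hr => ?_
    rw [uIcc_of_le hst] at hr
    exact pow_ne_zero 4 (hs0.trans_le hr.1).ne'
  have hac := c1.absolutelyContinuousOnInterval.fun_mul
    (((h.absolutelyContinuousOnInterval_discEnergy (b := b) ht0.le).mono hsub).fun_mul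
      ((h.neg.absolutelyContinuousOnInterval_discEnergy (b := b) ht0.le).mono hsub))
  have hint := hac.integral_deriv_eq_sub
  have hnn : 0 ≤ ∫ r in s..t, deriv (fun t => 1 / t ^ 4 *
        (discEnergy x b D u t * discEnergy x b D (fun y => -u y) t)) r := by
    rw [intervalIntegral.integral_of_le hst, integral_Ioc_eq_integral_Ioo]
    refine setIntegral_nonneg_of_ae_restrict ?_
    rw [EventuallyLE, ae_restrict_iff' measurableSet_Ioo]
    filter_upwards [h.ae_exists_hasDerivAt_nonneg hR hD] with r hr hr'
    have m1 : r ∈ Ioo s₁ s₂ := ⟨hs.1.trans hr'.1, hr'.2.trans_le ht.2⟩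
    obtain ⟨d, hd0, hd⟩ := hr ⟨hs0.trans hr'.1, m1.2.trans_le hs₂⟩ (hconn r m1)
    rw [hd.deriv]
    exact hd0
  linarith

end Admissible

end

section

/-! ### Small circles around a boundary point of a convex domain -/

variable {Ω : Set Plane} {x : Plane} {b : OrthonormalBasis (Fin 2) ℝ Plane}

/-- A convex open set lies in a half-plane with any given boundary point on its edge; `b 0` is the
inner normal. -/
theorem exists_frame (hΩ_open : IsOpen Ω) (hΩ_conv : Convex ℝ Ω) (hx : x ∈ frontier Ω) :
    ∃ b : OrthonormalBasis (Fin 2) ℝ Plane, ∀ y ∈ Ω, 0 < inner ℝ (y - x) (b 0) := by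
  have hxΩ : x ∉ Ω := by rw [hΩ_open.frontier_eq] at hx; exact hx.2
  obtain ⟨f, hf⟩ := geometric_hahn_banach_point_open hΩ_conv hΩ_open hxΩ
  set n := (InnerProductSpace.toDual ℝ Plane).symm f with hn
  have hfn : ∀ v, f v = inner ℝ n v := fun v =>
    (InnerProductSpace.toDual_symm_apply (𝕜 := ℝ)).symm
  have hpos : ∀ y ∈ Ω, 0 < inner ℝ (y - x) n := fun y hy => by
    rw [real_inner_comm, ← hfn, map_sub]; linarith [hf y hy]
  obtain ⟨y₀, hy₀⟩ : Ω.Nonempty := by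
    rw [← closure_nonempty_iff]; exact ⟨x, frontier_subset_closure hx⟩
  have hn0 : n ≠ 0 := fun h0 => by
    have := hpos y₀ hy₀
    rw [h0, inner_zero_right] at this
    exact lt_irrefl _ this
  have hnorm : 0 < ‖n‖ := norm_pos_iff.2 hn0
  have hv : Orthonormal ℝ (({0} : Set (Fin 2)).domRestrict fun _ => ‖n‖⁻¹ • n) := by
    refine ⟨fun i => ?_, fun i j hij => absurd (Subsingleton.elim i j) hij⟩
    rw [domRestrict_apply, norm_smul, norm_inv, norm_norm, inv_mul_cancel₀ hnorm.ne']
  obtain ⟨b, hb⟩ := hv.exists_orthonormalBasis_extension_of_card_eq (by simp)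
  refine ⟨b, fun y hy => ?_⟩
  rw [hb 0 rfl, inner_smul_right]
  exact mul_pos (inv_pos.2 hnorm) (hpos y hy)

theorem polarPt_mem_of_le (hΩ_open : IsOpen Ω) (hΩ_conv : Convex ℝ Ω) (hx : x ∈ closure Ω)
    {r s θ : ℝ} (hr : 0 < r) (hrs : r ≤ s) (hs : polarPt x b s θ ∈ Ω) :
    polarPt x b r θ ∈ Ω := by
  have hs0 : 0 < s := hr.trans_le hrs
  rw [← hΩ_open.interior_eq] at hs ⊢
  have h := hΩ_conv.add_smul_sub_mem_interior' hx hs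
    (t := r / s) ⟨by positivity, (div_le_one hs0).2 hrs⟩
  rwa [polarPt, add_sub_cancel_left, smul_smul, div_mul_cancel₀ _ hs0.ne'] at h

/-- The chord between two points of `Ω` with polar coordinates `(r₁, θ₁)` and `(r₂, θ₂)` meets the
ray at the intermediate angle `θ` at the radius
`r₁ r₂ sin (θ₂ - θ₁) / (r₁ sin (θ - θ₁) + r₂ sin (θ₂ - θ))`; all smaller radii belong to `Ω`. -/
theorem polarPt_mem_of_chord (hΩ_open : IsOpen Ω) (hΩ_conv : Convex ℝ Ω) (hx : x ∈ closure Ω)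
    {r r₁ r₂ θ θ₁ θ₂ : ℝ} (hr : 0 < r) (hr₁ : 0 < r₁) (hr₂ : 0 < r₂) (hθ₁ : θ₁ ≤ θ)
    (hθ₂ : θ ≤ θ₂) (hlt : θ₁ < θ₂) (hpi : θ₂ - θ₁ < Real.pi)
    (h₁ : polarPt x b r₁ θ₁ ∈ Ω) (h₂ : polarPt x b r₂ θ₂ ∈ Ω)
    (hle : r * (r₁ * Real.sin (θ - θ₁) + r₂ * Real.sin (θ₂ - θ)) ≤
      r₁ * r₂ * Real.sin (θ₂ - θ₁)) : polarPt x b r θ ∈ Ω := by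
  have hsin : 0 < Real.sin (θ₂ - θ₁) := Real.sin_pos_of_pos_of_lt_pi (by linarith) hpi
  have ha : 0 ≤ Real.sin (θ - θ₁) :=
    Real.sin_nonneg_of_nonneg_of_le_pi (by linarith) (by linarith)
  have hc : 0 ≤ Real.sin (θ₂ - θ) :=
    Real.sin_nonneg_of_nonneg_of_le_pi (by linarith) (by linarith)
  set S := r₁ * Real.sin (θ - θ₁) + r₂ * Real.sin (θ₂ - θ) with hS
  have hSpos : 0 < S := by
    rcases hθ₁.eq_or_lt with h | h
    · have : 0 < Real.sin (θ₂ - θ) := by rwa [← h]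
      positivity
    · have : 0 < Real.sin (θ - θ₁) := Real.sin_pos_of_pos_of_lt_pi (by linarith) (by linarith)
      positivity
  have hcomb := hΩ_conv h₁ h₂ (a := r₂ * Real.sin (θ₂ - θ) / S)
    (b := r₁ * Real.sin (θ - θ₁) / S) (by positivity) (by positivity)
    (by rw [← add_div, add_comm, ← hS, div_self hSpos.ne'])
  refine polarPt_mem_of_le hΩ_open hΩ_conv hx (s := r₁ * r₂ * Real.sin (θ₂ - θ₁) / S) hr
    ((le_div_iff₀ hSpos).2 hle) ?_
  convert hcomb using 1
  have hx1 : x = (r₂ * Real.sin (θ₂ - θ) / S) • x + (r₁ * Real.sin (θ - θ₁) / S) • x := by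
    rw [← add_smul, ← add_div, add_comm, ← hS, div_self hSpos.ne', one_smul]
  have hid : Real.sin (θ₂ - θ₁) • radialVec b θ =
      Real.sin (θ₂ - θ) • radialVec b θ₁ + Real.sin (θ - θ₁) • radialVec b θ₂ := by
    simp only [radialVec, smul_add, smul_smul]
    rw [add_add_add_comm, ← add_smul, ← add_smul]
    congr 2
    · simp only [Real.sin_sub]; ring
    · simp only [Real.sin_sub]; ring
  simp only [polarPt, smul_add]
  rw [add_add_add_comm, ← hx1]
  congr 1
  have e1 : (r₁ * r₂ * Real.sin (θ₂ - θ₁) / S) • radialVec b θ =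
      (r₁ * r₂ / S) • Real.sin (θ₂ - θ₁) • radialVec b θ := by
    rw [smul_smul]; congr 1; ring
  rw [e1, hid, smul_add]
  simp only [smul_smul]
  congr 2 <;> ring

theorem sin_add_le_of_le_pi_div_four {a c : ℝ} (ha : 0 ≤ a) (hc : 0 ≤ c)
    (hac : a + c ≤ Real.pi / 4) : 4 * Real.sin a + Real.sin c ≤ 4 * Real.sin (a + c) := by
  have hpi := Real.pi_pos
  have h1 : Real.sin (a + c) - Real.sin a = 2 * Real.sin (c / 2) * Real.cos (a + c / 2) := by
    rw [Real.sin_sub_sin]; congr 2 <;> ring_nf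
  have h2 : Real.sin c = 2 * Real.sin (c / 2) * Real.cos (c / 2) := by
    rw [← Real.sin_two_mul]; ring_nf
  have h3 : 0 ≤ Real.sin (c / 2) :=
    Real.sin_nonneg_of_nonneg_of_le_pi (by linarith) (by linarith)
  have h4 : 1 / 2 ≤ Real.cos (a + c / 2) := by
    rw [← Real.cos_pi_div_three]
    exact Real.cos_le_cos_of_nonneg_of_le_pi (by linarith) (by linarith) (by linarith)
  have h5 := Real.cos_le_one (c / 2)
  nlinarith

/-- Small circles around a boundary point of a convex domain meet the domain in a single arc.
The tangent cone at `x` is an open sector of opening at most `π`; the two rays that cut off a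
quarter of the opening on each side are the reference directions. For small `r` the domain contains
the points at distance `4 r` in these directions, and the chords from these to each other and to the
points at distance `r` in the outer quarters stay outside the ball of radius `r`. -/
theorem exists_isConnected_sphere_inter (hΩ_open : IsOpen Ω) (hΩ_conv : Convex ℝ Ω)
    (hx : x ∈ frontier Ω) :
    ∃ ρ : ℝ, 0 < ρ ∧ ∀ r ∈ Ioo 0 ρ, IsConnected (Metric.sphere x r ∩ Ω) := by
  obtain ⟨b, hb⟩ := exists_frame hΩ_open hΩ_conv hx
  have hxc := frontier_subset_closure hx
  have hpi := Real.pi_pos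
  have hcont : ∀ r, Continuous fun θ => polarPt x b r θ := fun r =>
    (continuous_polarPt x b).comp (continuous_const.prodMk continuous_id)
  set I := Ioo (-(Real.pi / 2)) (Real.pi / 2) with hI
  set Θ : Set ℝ := I ∩ {θ | ∃ s > 0, polarPt x b s θ ∈ Ω} with hΘ
  have hΘo : IsOpen Θ := by
    refine isOpen_Ioo.inter (isOpen_iff_mem_nhds.2 ?_)
    rintro θ ⟨s, hs, hm⟩
    filter_upwards [(hΩ_open.preimage (hcont s)).mem_nhds hm] with θ' hθ'
    exact ⟨s, hs, hθ'⟩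
  have hΘne : Θ.Nonempty := by
    obtain ⟨y, hy⟩ : Ω.Nonempty := by rw [← closure_nonempty_iff]; exact ⟨x, hxc⟩
    have h1 := hb y hy
    refine ⟨polarAngle x b y, polarAngle_mem h1, ‖y - x‖, ?_, ?_⟩
    · refine norm_pos_iff.2 fun h0 => ?_
      rw [h0, inner_zero_left] at h1
      exact lt_irrefl _ h1
    · rwa [polarPt_polarAngle h1]
  have hΘc : Θ.OrdConnected := by
    refine ordConnected_iff.2 fun θ₁ h₁ θ₂ h₂ hlt θ hθ => ?_
    refine ⟨ordConnected_Ioo.out h₁.1 h₂.1 hθ, ?_⟩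
    obtain ⟨s₁, hs₁, hm₁⟩ := h₁.2
    obtain ⟨s₂, hs₂, hm₂⟩ := h₂.2
    have hlen : θ₂ - θ₁ < Real.pi := by linarith [h₁.1.1, h₂.1.2]
    rcases hlt.eq_or_lt with heq | hlt
    · have : θ = θ₁ := le_antisymm (heq ▸ hθ.2) hθ.1
      exact ⟨s₁, hs₁, this ▸ hm₁⟩
    · have hsin : 0 < Real.sin (θ₂ - θ₁) := Real.sin_pos_of_pos_of_lt_pi (by linarith) hlen
      have h1 : 0 < s₁ + s₂ := by linarith
      refine ⟨s₁ * s₂ * Real.sin (θ₂ - θ₁) / (s₁ + s₂), by positivity, ?_⟩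
      refine polarPt_mem_of_chord hΩ_open hΩ_conv hxc (by positivity) hs₁ hs₂ hθ.1 hθ.2 hlt hlen
        hm₁ hm₂ ?_
      rw [div_mul_eq_mul_div, div_le_iff₀ h1]
      refine mul_le_mul_of_nonneg_left ?_ (by positivity)
      exact add_le_add (mul_le_of_le_one_right hs₁.le (Real.sin_le_one _))
        (mul_le_of_le_one_right hs₂.le (Real.sin_le_one _))
  have hΘb : BddBelow Θ := ⟨-(Real.pi / 2), fun θ hθ => hθ.1.1.le⟩
  have hΘa : BddAbove Θ := ⟨Real.pi / 2, fun θ hθ => hθ.1.2.le⟩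
  have hΘeq := eq_Ioo_of_isOpen_of_isConnected hΘo ⟨hΘne, hΘc.isPreconnected⟩ hΘb hΘa
  set lo := sInf Θ
  set hi := sSup Θ
  have hlohi : lo < hi := by
    obtain ⟨θ, hθ⟩ := hΘne
    rw [hΘeq] at hθ
    exact hθ.1.trans hθ.2
  have hlen : hi - lo ≤ Real.pi := by
    have h1 : -(Real.pi / 2) ≤ lo := le_csInf hΘne fun θ hθ => hθ.1.1.le
    have h2 : hi ≤ Real.pi / 2 := csSup_le hΘne fun θ hθ => hθ.1.2.le
    linarith
  set θa := lo + (hi - lo) / 4 with hθa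
  set θb := hi - (hi - lo) / 4 with hθb
  have hma : θa ∈ Θ := by rw [hΘeq]; constructor <;> linarith
  have hmb : θb ∈ Θ := by rw [hΘeq]; constructor <;> linarith
  have hab : θa < θb := by linarith
  obtain ⟨hIa, sa, hsa, hpa⟩ := hma
  obtain ⟨hIb, sb, hsb, hpb⟩ := hmb
  refine ⟨min sa sb / 4, by positivity, fun r hr => ?_⟩
  have hr0 : 0 < r := hr.1
  have hr4 : 4 * r ≤ min sa sb := by linarith [hr.2]
  have h4a : polarPt x b (4 * r) θa ∈ Ω := polarPt_mem_of_le hΩ_open hΩ_conv hxc (by linarith)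
    (hr4.trans (min_le_left _ _)) hpa
  have h4b : polarPt x b (4 * r) θb ∈ Ω := polarPt_mem_of_le hΩ_open hΩ_conv hxc (by linarith)
    (hr4.trans (min_le_right _ _)) hpb
  set T : Set ℝ := I ∩ {θ | polarPt x b r θ ∈ Ω} with hT
  have hTΘ : T ⊆ Ioo lo hi := fun θ hθ => by rw [← hΘeq]; exact ⟨hθ.1, r, hr0, hθ.2⟩
  have hmid : ∀ θ ∈ Icc θa θb, polarPt x b r θ ∈ Ω := by
    intro θ hθ
    refine polarPt_mem_of_chord hΩ_open hΩ_conv hxc hr0 (by linarith) (by linarith) hθ.1 hθ.2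
      hab (by linarith) h4a h4b ?_
    have h1 : Real.sin (θ - θa) ≤ Real.sin (θb - θa) :=
      Real.sin_le_sin_of_le_of_le_pi_div_two (by linarith [hθ.1]) (by linarith)
        (by linarith [hθ.2])
    have h2 : Real.sin (θb - θ) ≤ Real.sin (θb - θa) :=
      Real.sin_le_sin_of_le_of_le_pi_div_two (by linarith [hθ.2]) (by linarith)
        (by linarith [hθ.1])
    have h3 : 0 ≤ Real.sin (θb - θa) :=
      Real.sin_nonneg_of_nonneg_of_le_pi (by linarith) (by linarith)
    have hrr : 0 < r * r := by positivity
    nlinarith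
  have hleft : ∀ θ₂ ∈ T, θ₂ < θa → ∀ θ ∈ Icc θ₂ θa, polarPt x b r θ ∈ Ω := by
    intro θ₂ h₂ hlt θ hθ
    have h0 := (hTΘ h₂).1
    refine polarPt_mem_of_chord hΩ_open hΩ_conv hxc hr0 hr0 (by linarith) hθ.1 hθ.2
      hlt (by linarith) h₂.2 h4a ?_
    have h1 := sin_add_le_of_le_pi_div_four (a := θa - θ) (c := θ - θ₂) (by linarith [hθ.2])
      (by linarith [hθ.1]) (by linarith)
    rw [sub_add_sub_cancel] at h1
    have hrr : 0 < r * r := by positivity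
    nlinarith
  have hright : ∀ θ₂ ∈ T, θb < θ₂ → ∀ θ ∈ Icc θb θ₂, polarPt x b r θ ∈ Ω := by
    intro θ₂ h₂ hlt θ hθ
    have h0 := (hTΘ h₂).2
    refine polarPt_mem_of_chord hΩ_open hΩ_conv hxc hr0 (by linarith) hr0 hθ.1 hθ.2
      hlt (by linarith) h4b h₂.2 ?_
    have h1 := sin_add_le_of_le_pi_div_four (a := θ - θb) (c := θ₂ - θ) (by linarith [hθ.1])
      (by linarith [hθ.2]) (by linarith)
    rw [add_comm (θ - θb), sub_add_sub_cancel] at h1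
    have hrr : 0 < r * r := by positivity
    nlinarith
  have hTa : θa ∈ T := ⟨hIa, hmid θa (left_mem_Icc.2 hab.le)⟩
  have hTc : IsConnected T := by
    refine ⟨⟨θa, hTa⟩, isPreconnected_of_forall θa fun θ₂ h₂ => ⟨uIcc θa θ₂, fun θ hθ =>
      ⟨ordConnected_Ioo.uIcc_subset hIa h₂.1 hθ, ?_⟩, left_mem_uIcc, right_mem_uIcc,
      isPreconnected_uIcc⟩⟩
    rcases lt_or_ge θ₂ θa with h | h
    · rw [uIcc_of_ge h.le] at hθ
      exact hleft θ₂ h₂ h θ hθ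
    · rw [uIcc_of_le h] at hθ
      rcases le_total θ θb with h' | h'
      · exact hmid θ ⟨hθ.1, h'⟩
      · rcases h'.eq_or_lt with h'' | h''
        · exact hmid θ ⟨hθ.1, h''.ge⟩
        · exact hright θ₂ h₂ (h''.trans_le hθ.2) θ ⟨h', hθ.2⟩
  have himg : Metric.sphere x r ∩ Ω = (fun θ => polarPt x b r θ) '' T := by
    ext y
    constructor
    · rintro ⟨hy1, hy2⟩
      have h1 := hb y hy2
      have h2 := polarPt_polarAngle h1
      rw [mem_sphere_iff_norm.1 hy1] at h2
      exact ⟨polarAngle x b y, ⟨polarAngle_mem h1, by rw [mem_ofPred_eq, h2]; exact hy2⟩, h2⟩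
    · rintro ⟨θ, hθ, rfl⟩
      exact ⟨by rw [mem_sphere_iff_norm, norm_polarPt_sub x b hr0.le], hθ.2⟩
  rw [himg]
  exact hTc.image _ (hcont r).continuousOn

/-! ### From the weak formulation to the monotonicity formula -/

/-- The hypotheses on `u`, in terms of weak gradients, give the conditions in terms of the classical
gradient off the zero set. -/
theorem admissible_of_neumannWeakly {S : Set Plane} {r₀ R : ℝ} {u : Plane → ℝ}
    (hΩ_open : IsOpen Ω) (hxN : x ∈ frontier Ω) (hxS : ∀ y ∈ S, r₀ ≤ dist x y) (hR : R ≤ r₀)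
    (hu : ContinuousOn u (Metric.ball x R ∩ Ω)) (hH1 : MemH1 (Metric.ball x R ∩ Ω) u)
    (hharm : InnerProductSpace.HarmonicOnNhd u ((Metric.ball x R ∩ Ω) \ {y | u y = 0}))
    (hN : NeumannWeakly (Metric.ball x R ∩ Ω) (Metric.ball x R ∩ (frontier Ω \ S)) u) :
    Admissible (Metric.ball x R ∩ Ω) x R u := by
  set D := Metric.ball x R ∩ Ω with hD
  have hDo : IsOpen D := Metric.isOpen_ball.inter hΩ_open
  have hxΩ : x ∉ Ω := by rw [hΩ_open.frontier_eq] at hxN; exact hxN.2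
  have hC : ∀ y ∈ D, u y ≠ 0 → ContDiffAt ℝ 1 u y := fun y hy h0 =>
    (hharm y ⟨hy, h0⟩).1.of_le (by norm_num)
  set Z := D ∩ {y | u y ≠ 0} with hZ
  have hZo : IsOpen Z := hu.isOpen_inter_preimage hDo isOpen_ne
  obtain ⟨hL2, g, hg2, hg⟩ := hH1
  have hgZ : gradient u =ᵐ[volume.restrict Z] g :=
    (hasWeakGradOn_of_contDiffOn hZo fun y hy => (hC y hy.1 hy.2).contDiffWithinAt).ae_eq hZo
      (hg.mono inter_subset_left)
  have hgZ' : ∀ᵐ y, y ∈ Z → gradient u y = g y := (ae_restrict_iff' hZo.measurableSet).1 hgZ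
  refine ⟨hDo, inter_subset_left, fun h => hxΩ h.2, hu, hC, hL2, ?_, ?_⟩
  · refine (hg2.indicator hZo.measurableSet).ae_eq ?_
    refine ae_restrict_of_ae ?_
    filter_upwards [hgZ'] with y hy
    by_cases hyZ : y ∈ Z
    · rw [indicator_of_mem hyZ, indicator_of_mem hyZ, hy hyZ]
    · rw [indicator_of_notMem hyZ, indicator_of_notMem hyZ]
  · rintro φ hφ hφ2 hφg ⟨r', hr', hφr⟩ ⟨ε, hε, hφε⟩
    have hwφ := hasWeakGradOn_of_contDiffOn hDo hφ
    have := hN φ ⟨hφ2, _, hφg, hwφ⟩ ⟨{y | r' < dist y x}, ?_, ?_, ?_⟩ ⟨ε, hε, hφε⟩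
    · rw [← this]
      refine integral_congr_ae ?_
      filter_upwards [hg.weakGrad_ae_eq hDo, hwφ.weakGrad_ae_eq hDo, ae_restrict_of_ae hgZ',
        ae_restrict_mem hDo.measurableSet] with y h1 h2 h3 hy
      rw [h1, h2]
      by_cases h0 : u y = 0
      · -- the test function vanishes near the zeros of `u`
        have hloc : φ =ᶠ[𝓝 y] fun _ => 0 := by
          have habs : ContinuousAt (fun z => |u z|) y := (hu.continuousAt (hDo.mem_nhds hy)).abs
          filter_upwards [habs.eventually_lt_const (u := ε) (by simpa [h0] using hε),
            hDo.mem_nhds hy] with z hz hzD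
          exact hφε z hzD hz
        have : gradient φ y = 0 := by rw [gradient, hloc.fderiv_eq]; simp
        rw [this, inner_zero_right, inner_zero_right]
      · rw [h3 ⟨hy, h0⟩]
    · exact isOpen_lt continuous_const (continuous_id.dist continuous_const)
    · -- the part of the boundary inside `B_R(x)` avoids `S`
      rintro y ⟨hyf, hyN⟩
      refine hr'.trans_le ?_
      by_contra! hlt
      have hyB : y ∈ Metric.ball x R := hlt
      have hyc : y ∈ closure Ω := closure_mono inter_subset_right (frontier_subset_closure hyf)
      have hyD : y ∉ D := by rw [hDo.frontier_eq] at hyf; exact hyf.2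
      refine hyN ⟨hyB, ?_, fun hyS => ?_⟩
      · rw [hΩ_open.frontier_eq]
        exact ⟨hyc, fun hyΩ => hyD ⟨hyB, hyΩ⟩⟩
      · have := hxS y hyS
        rw [dist_comm] at this
        linarith
    · rintro y ⟨hyD, hyV⟩
      exact hφr y hyD (le_of_lt hyV)

theorem Admissible.energy_ball_inter {R : ℝ} {u : Plane → ℝ}
    (h : Admissible (Metric.ball x R ∩ Ω) x R u) (hΩ_open : IsOpen Ω) {r : ℝ} (hr : 0 ≤ r)
    (hrR : r ≤ R) :
    energy (Metric.ball x r ∩ Ω) (posPt u) = discEnergy x b (Metric.ball x R ∩ Ω) u r := by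
  rw [h.energy_posPt (Metric.isOpen_ball.inter hΩ_open)
    (inter_subset_inter_left _ (Metric.ball_subset_ball hrR)), ← h.integral_ball_density hr]
  refine (setIntegral_eq_of_subset_of_forall_sdiff_eq_zero measurableSet_ball
    inter_subset_left fun y hy => ?_).symm
  exact indicator_of_notMem (fun hp => hy.2 ⟨hy.1, hp.1.2⟩) _

theorem Admissible.acfPhi_eq {R : ℝ} {u : Plane → ℝ}
    (h : Admissible (Metric.ball x R ∩ Ω) x R u) (hΩ_open : IsOpen Ω) {r : ℝ} (hr : 0 ≤ r)
    (hrR : r ≤ R) :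
    acfPhi Ω u x r = 1 / r ^ 4 * (discEnergy x b (Metric.ball x R ∩ Ω) u r *
      discEnergy x b (Metric.ball x R ∩ Ω) (fun y => -u y) r) := by
  rw [acfPhi, h.energy_ball_inter hΩ_open hr hrR,
    show negPt u = posPt fun y => -u y from rfl, h.neg.energy_ball_inter hΩ_open hr hrR]

end

end ACFNeumann

end

theorem lemma3p1 (Ω S : Set ACFNeumann.Plane)
    (hΩ_open : IsOpen Ω) (hΩ_conv : Convex ℝ Ω) (hΩ_bdd : Bornology.IsBounded Ω)
    (hS : S ⊆ frontier Ω)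
    (x : ACFNeumann.Plane) (hxN : x ∈ frontier Ω \ S)
    (r₀ : ℝ) (hr₀ : 0 < r₀) (hxS : ∀ y ∈ S, r₀ ≤ dist x y) :
    (∃ ρ : ℝ, 0 < ρ ∧ ∀ r ∈ Ioo 0 ρ, IsConnected (Metric.sphere x r ∩ Ω)) ∧
    ∀ (R : ℝ) (u : ACFNeumann.Plane → ℝ), 0 < R → R ≤ r₀ →
      (∃ y ∈ ACFNeumann.freeBoundary Ω u, dist x y < r₀) →
      ContinuousOn u (Metric.ball x R ∩ Ω) →
      ACFNeumann.MemH1 (Metric.ball x R ∩ Ω) u →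
      InnerProductSpace.HarmonicOnNhd u ((Metric.ball x R ∩ Ω) \ {y | u y = 0}) →
      ACFNeumann.NeumannWeakly (Metric.ball x R ∩ Ω) (Metric.ball x R ∩ (frontier Ω \ S)) u →
        ACFNeumann.MemH1 (Metric.ball x R ∩ Ω) (ACFNeumann.posPt u) ∧
        ACFNeumann.MemH1 (Metric.ball x R ∩ Ω) (ACFNeumann.negPt u) ∧
        (∀ᵐ r : ℝ, r ∈ Ioo 0 R → IsConnected (Metric.sphere x r ∩ Ω) →
          DifferentiableAt ℝ (ACFNeumann.acfPhi Ω u x) r ∧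
            0 ≤ deriv (ACFNeumann.acfPhi Ω u x) r) ∧
        (∀ a b : ℝ, 0 ≤ a → b ≤ R →
          (∀ r ∈ Ioo a b, IsConnected (Metric.sphere x r ∩ Ω)) →
          MonotoneOn (ACFNeumann.acfPhi Ω u x) (Ioc a b)) := by
  refine ⟨ACFNeumann.exists_isConnected_sphere_inter hΩ_open hΩ_conv hxN.1, ?_⟩
  intro R u hR hRr₀ _ hu hH1 hharm hN
  have h := ACFNeumann.admissible_of_neumannWeakly hΩ_open hxN.1 hxS hRr₀ hu hH1 hharm hN
  obtain ⟨b, hb⟩ := ACFNeumann.exists_frame hΩ_open hΩ_conv hxN.1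
  have hD : ∀ y ∈ Metric.ball x R ∩ Ω, 0 < inner ℝ (y - x) (b 0) := fun y hy => hb y hy.2
  have hsphere : ∀ r < R, Metric.sphere x r ∩ (Metric.ball x R ∩ Ω) = Metric.sphere x r ∩ Ω := by
    intro r hr
    rw [← inter_assoc, inter_eq_self_of_subset_left (Metric.sphere_subset_ball hr)]
  refine ⟨h.memH1_posPt, h.neg.memH1_posPt, ?_, ?_⟩
  · filter_upwards [h.ae_exists_hasDerivAt_nonneg hR hD] with r hr hrR hconn
    obtain ⟨d, hd0, hd⟩ := hr hrR (by rwa [hsphere r hrR.2])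
    have hd' : HasDerivAt (ACFNeumann.acfPhi Ω u x) d r := by
      refine hd.congr_of_eventuallyEq ?_
      filter_upwards [Ioo_mem_nhds hrR.1 hrR.2] with s hs
      exact h.acfPhi_eq hΩ_open hs.1.le hs.2.le
    exact ⟨hd'.differentiableAt, by rw [hd'.deriv]; exact hd0⟩
  · intro s₁ s₂ hs₁ hs₂ hconn
    have hmono := h.monotoneOn_energy_product hR hD hs₁ hs₂ fun r hr => by
      rw [hsphere r (hr.2.trans_le hs₂)]; exact hconn r hr
    refine hmono.congr fun r hr => ?_
    exact (h.acfPhi_eq hΩ_open (hs₁.trans hr.1.le) (hr.2.trans hs₂)).symm
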